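/- Notation. $I_0=(-1,1)$; for $I=(-a,a)$ with $a$ a positive integer put $a_I=a$, $nI=(-na,na)$, $\overline I=[-a,a]$, and let $S^d\subseteq\mathbb R^d$ be the $d$-th Cartesian power of $S\subseteq\mathbb R$. For a complete $C^\infty$ vector field $V$ on $\mathbb R^d$, $\Phi^V_t$ is its time-$t$ flow. Let $\mathcal C$ be the set of $C^\infty$ maps $V:\mathbb R^4\to\mathbb R^4$ with values in $[-1,1]^4$ (all of them are complete vector fields), and $V_0:=(0,0,0,1)$ (constant). For $I=(-a_I,a_I)$ let $\xi_I=(0,0,0,-a_I)$ and $B_\circ(I)=I^3\times\{-a_I\}$. Two maps that are smooth near a point agree there to all orders if their values and all their derivatives at this point coincide. Let $\mathcal P_I$ be the set of pairs $(P,K)$ such that: $P\in\mathcal C$; $K=(-b,b)$ for some positive integer $b$; $P=V_0$ on $\mathbb R^4\setminus K^4$; $4I\subseteq K$; $P=V_0$ on $(\overline{3I})^4$; and, for some integer $m>2a_I$, - $\Phi^P_m$ agrees with the identity of $\mathbb R^4$ to all orders at $\xi_I$, and - for all $\tau\in B_\circ(I)$ and all $t\in(0,m)$: $\Phi^P_t(\tau)\in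 I^4$ if and only if $t<2a_I$. Data. Let the following be given. - A $C^\infty$ function $\zeta:\mathbb R\to\mathbb R$ with $\zeta=1$ on $(-\infty,0]$, $\zeta=0$ on $[1,\infty)$ and $\zeta'<0$ on $(0,1)$. Put $\zeta_I(x)=\zeta(|x|-a_I)$ and $\alpha(y,z)=1-\zeta_{3I_0}(y)\,\zeta_{3I_0}(z)$. - A $C^\infty$ function $c_0:\mathbb R^2\to\mathbb R$ with $0<c_0<1$ on $\mathbb R^2\setminus\{(0,0)\}$, which agrees with the zero function to all orders at $(0,0)$ and satisfies $c_0(w,x)\,(w,-x)\in[-1,1]^2$ for all $(w,x)$. Put $H(w,x)=c_0(w,x)\,(w,-x)$. - An open set $R\subseteq\mathbb R^2$ diffeomorphic to an open annulus, a $C^\infty$ map $Q:\mathbb R^2\to[-1,1]^2$ and an integer $m>24$ such that, with $S=(-4,4)\times(-12,12)$, $B=(-4,4)\times\{-12\}$ and $T=(-4,4)\times\{12\}$: $S\cup B\cup T\subseteq R\subseteq(-50,50)^2$; $R$ is invariant under the flow of $Q$; $Q=(0,1)$ on $S$ and on $\mathbb R^2\setminus(-50,50)^2$; $\Phi^Q_m(v)=v$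 for all $v\in R$; and, for all $v\in B$ and $t\in(0,m)$, $\Phi^Q_t(v)\in S$ if and only if $t<24$. - $C^\infty$ functions $\beta,\gamma:\mathbb R^4\to[0,1]$ with $\beta=1$ on $[-100,100]^4$, $\beta=0$ off $(-200,200)^4$, $\gamma=1$ on $[-300,300]^4$ and $\gamma=0$ off $(-400,400)^4$. For $(u,v)\in\mathbb R^2\times\mathbb R^2=\mathbb R^4$ define $$P_*(u,v)=(\alpha(v)H(u),\,Q(v)),\qquad X(u,v)=(H(u),\,(0,1)),$$ $$P_+=\beta P_*+(1-\beta)X,\qquad P_0=\gamma P_++(1-\gamma)V_0,\qquad K_0=(-400,400).$$ Claim. For every choice of these data, $(P_0,K_0)\in\mathcal P_{I_0}$. -/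

import Mathlib

open scoped ContDiff

noncomputable section

namespace WaterPump

/-! ### Intervals and boxes -/

/-- The set of intervals `(-a, a)` with `a` a positive integer. -/
def symmIntervals : Set (Set ℝ) :=
  {I | ∃ a : ℕ, 0 < a ∧ I = Set.Ioo (-(a : ℝ)) a}

/-- The half-length `a_I = sup I` of a symmetric interval `I = (-a_I, a_I)`. -/
def halfLen (I : Set ℝ) : ℝ := sSup I

/-- The dilated interval `n I = (-n a_I, n a_I)`. -/
def dilate (n : ℕ) (I : Set ℝ) : Set ℝ := Set.Ioo (-(n * halfLen I)) (n * halfLen I)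

/-- `I₀ = (-1, 1)`. -/
def I₀ : Set ℝ := Set.Ioo (-1) 1

/-- The Cartesian power `S^d ⊆ ℝ^d`. -/
def cube (d : ℕ) (S : Set ℝ) : Set (Fin d → ℝ) := {x | ∀ i, x i ∈ S}

/-! ### Flows and agreement to all orders -/

/-- The time-`t` flow of a vector field on `ℝ^d`: the value at time `t` of the curve `γ : ℝ → ℝ^d`
with `γ' = V ∘ γ` and `γ 0 = σ`. For a smooth complete `V` this curve exists and is unique
(see `flow_eq`); the value `σ` is a default, used only if there is no such curve. -/
def flow {d : ℕ} (V : (Fin d → ℝ) → (Fin d → ℝ)) (t : ℝ) (σ : Fin d → ℝ) : Fin d → ℝ :=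
  open scoped Classical in
  if h : ∃ γ : ℝ → (Fin d → ℝ), γ 0 = σ ∧ ∀ s, HasDerivAt γ (V (γ s)) s
  then h.choose t else σ

/-- The flow of a smooth vector field is given by any global integral curve, so that it does not
depend on the choice made in its definition. -/
theorem flow_eq {d : ℕ} {V : (Fin d → ℝ) → (Fin d → ℝ)} (hV : ContDiff ℝ ∞ V)
    {γ : ℝ → (Fin d → ℝ)} (hγ : ∀ s, HasDerivAt γ (V (γ s)) s) (t : ℝ) :
    flow V t (γ 0) = γ t := by
  have h : ∃ δ : ℝ → (Fin d → ℝ), δ 0 = γ 0 ∧ ∀ s, HasDerivAt δ (V (δ s)) s := ⟨γ, rfl, hγ⟩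
  have key : ∀ δ : ℝ → (Fin d → ℝ), δ 0 = γ 0 → (∀ s, HasDerivAt δ (V (δ s)) s) →
      δ t = γ t := by
    intro δ h0 hδ
    set J : Set ℝ := Set.Icc (-(|t| + 1)) (|t| + 1)
    set C : Set (Fin d → ℝ) := γ '' J ∪ δ '' J
    have hγc : Continuous γ := continuous_iff_continuousAt.2 fun s => (hγ s).continuousAt
    have hδc : Continuous δ := continuous_iff_continuousAt.2 fun s => (hδ s).continuousAt
    have hC : IsCompact C := (isCompact_Icc.image hγc).union (isCompact_Icc.image hδc)
    have hV1 : ContDiff ℝ 1 V := hV.of_le (by exact_mod_cast le_top)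
    obtain ⟨K, hK⟩ := (hV1.locallyLipschitz.locallyLipschitzOn
      (s := C)).exists_lipschitzOnWith_of_compact hC
    have ht : t ∈ Set.Ioo (-(|t| + 1)) (|t| + 1) := by
      constructor <;> linarith [neg_abs_le t, le_abs_self t]
    have h0' : (0 : ℝ) ∈ Set.Ioo (-(|t| + 1)) (|t| + 1) := by
      constructor <;> linarith [abs_nonneg t]
    exact ODE_solution_unique_of_mem_Ioo (v := fun _ => V) (s := fun _ => C)
      (fun _ _ => hK) h0'
      (fun s hs => ⟨hδ s, Or.inr ⟨s, Set.Ioo_subset_Icc_self hs, rfl⟩⟩)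
      (fun s hs => ⟨hγ s, Or.inl ⟨s, Set.Ioo_subset_Icc_self hs, rfl⟩⟩) h0 ht
  rw [flow, dif_pos h]
  exact key _ h.choose_spec.1 h.choose_spec.2

/-- Two maps agree to all orders at `σ`: both are smooth near `σ`, and their values and all of
their derivatives at `σ` coincide. -/
def AgreeToAllOrders {E F : Type*} [NormedAddCommGroup E] [NormedSpace ℝ E]
    [NormedAddCommGroup F] [NormedSpace ℝ F] (f g : E → F) (σ : E) : Prop :=
  ContDiffAt ℝ ∞ f σ ∧ ContDiffAt ℝ ∞ g σ ∧
    ∀ k : ℕ, iteratedFDeriv ℝ k f σ = iteratedFDeriv ℝ k g σ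

/-! ### The class `𝒫_I` -/

/-- The smooth vector fields on `ℝ⁴` with values in `[-1, 1]⁴`. -/
def boundedFields : Set ((Fin 4 → ℝ) → (Fin 4 → ℝ)) :=
  {V | ContDiff ℝ ∞ V ∧ ∀ σ, V σ ∈ cube 4 (closure I₀)}

/-- The constant vector field `(0, 0, 0, 1)`. -/
def V₀ : (Fin 4 → ℝ) → (Fin 4 → ℝ) := fun _ => ![0, 0, 0, 1]

/-- The open bottom face `I³ × {-a_I}` of the cube `I⁴`. -/
def bottom (I : Set ℝ) : Set (Fin 4 → ℝ) :=
  {τ | τ 0 ∈ I ∧ τ 1 ∈ I ∧ τ 2 ∈ I ∧ τ 3 = -halfLen I}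

/-- The center `ξ_I = (0, 0, 0, -a_I)` of the bottom face. -/
def xi (I : Set ℝ) : Fin 4 → ℝ := ![0, 0, 0, -halfLen I]

/-- Deterrence systems: pairs `(V, I)` such that `V = V₀` outside of `I⁴`. -/
def deterrenceSystems : Set (((Fin 4 → ℝ) → (Fin 4 → ℝ)) × Set ℝ) :=
  {VI | VI.1 ∈ boundedFields ∧ VI.2 ∈ symmIntervals ∧ ∀ σ, σ ∉ cube 4 VI.2 → VI.1 σ = V₀ σ}

/-- The class `𝒞_I` of the `P` in `boundedFields` that agree with `V₀` on the closure of
`(3I)⁴`. -/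
def fieldsStraightOn (I : Set ℝ) : Set ((Fin 4 → ℝ) → (Fin 4 → ℝ)) :=
  {P | P ∈ boundedFields ∧ ∀ σ ∈ cube 4 (closure (dilate 3 I)), P σ = V₀ σ}

/-- The class `𝒟_I^×`. -/
def exchangeSystems (I : Set ℝ) : Set (((Fin 4 → ℝ) → (Fin 4 → ℝ)) × Set ℝ) :=
  {PK | PK ∈ deterrenceSystems ∧ dilate 4 I ⊆ PK.2 ∧ PK.1 ∈ fieldsStraightOn I}

/-- The class `𝒫_I`. -/
def scrP (I : Set ℝ) : Set (((Fin 4 → ℝ) → (Fin 4 → ℝ)) × Set ℝ) :=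
  {PK | PK ∈ exchangeSystems I ∧ ∃ m : ℤ, 2 * halfLen I < m ∧
    AgreeToAllOrders (flow PK.1 m) id (xi I) ∧
    ∀ τ ∈ bottom I, ∀ t ∈ Set.Ioo (0 : ℝ) m,
      (flow PK.1 t τ ∈ cube 4 I ↔ t < 2 * halfLen I)}

/-! ### The auxiliary functions -/

/-- A smooth step function: `1` on `(-∞, 0]`, `0` on `[1, ∞)`, with negative derivative on
`(0, 1)`. -/
structure IsStep (ζ : ℝ → ℝ) : Prop where
  smooth : ContDiff ℝ ∞ ζ
  eq_one : ∀ x ≤ 0, ζ x = 1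
  eq_zero : ∀ x, 1 ≤ x → ζ x = 0
  deriv_neg : ∀ x ∈ Set.Ioo (0 : ℝ) 1, deriv ζ x < 0

/-- The plateau function `ζ_I` built from the step function `ζ`. -/
def plateau (ζ : ℝ → ℝ) (I : Set ℝ) (x : ℝ) : ℝ :=
  if x ≤ 0 then ζ (-x - halfLen I) else ζ (x - halfLen I)

/-- A smooth function `ℝ⁴ → [0, 1]` which is `1` on the closure of `J⁴` and `0` off `K⁴`. -/
structure IsCutoff (J K : Set ℝ) (β : (Fin 4 → ℝ) → ℝ) : Prop where
  smooth : ContDiff ℝ ∞ β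
  mem_Icc : ∀ ρ, β ρ ∈ Set.Icc (0 : ℝ) 1
  eq_one : ∀ ρ ∈ cube 4 (closure J), β ρ = 1
  eq_zero : ∀ ρ, ρ ∉ cube 4 K → β ρ = 0

/-! ### The hyperbolic vector field -/

/-- The linear hyperbolic vector field `(w, x) ↦ (w, -x)`. -/
def H₀ (u : Fin 2 → ℝ) : Fin 2 → ℝ := ![u 0, -u 1]

/-- The slowing factor of the hyperbolic vector field. -/
structure IsSlowing (c₀ : (Fin 2 → ℝ) → ℝ) : Prop where
  smooth : ContDiff ℝ ∞ c₀
  mem_Ioo : ∀ u, u ≠ 0 → c₀ u ∈ Set.Ioo (0 : ℝ) 1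
  bounded : ∀ u, c₀ u • H₀ u ∈ cube 2 (closure I₀)
  flat : AgreeToAllOrders c₀ (fun _ => 0) 0

/-- The hyperbolic vector field `H = c₀ H₀`. -/
def hyp (c₀ : (Fin 2 → ℝ) → ℝ) (u : Fin 2 → ℝ) : Fin 2 → ℝ := c₀ u • H₀ u

/-! ### The racetrack vector field -/

/-- The constant vector field `(0, 1)`. -/
def Q₀ : (Fin 2 → ℝ) → (Fin 2 → ℝ) := fun _ => ![0, 1]

/-- The straight part `S = (4I₀) × (12I₀)` of the racetrack. -/
def straight : Set (Fin 2 → ℝ) := {v | v 0 ∈ dilate 4 I₀ ∧ v 1 ∈ dilate 12 I₀}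

/-- The starting line `B = (4I₀) × {-12}`. -/
def startLine : Set (Fin 2 → ℝ) := {v | v 0 ∈ dilate 4 I₀ ∧ v 1 = -12}

/-- The checkpoint `T = (4I₀) × {12}`. -/
def checkpoint : Set (Fin 2 → ℝ) := {v | v 0 ∈ dilate 4 I₀ ∧ v 1 = 12}

/-- The open annulus in `ℝ²` with center `0` and radii `r₁ < r₂`, for the Euclidean distance. -/
def annulus (r₁ r₂ : ℝ) : Set (Fin 2 → ℝ) :=
  {x | r₁ ^ 2 < x 0 ^ 2 + x 1 ^ 2 ∧ x 0 ^ 2 + x 1 ^ 2 < r₂ ^ 2}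

/-- The subset `R` of `ℝ²` is diffeomorphic to an open annulus in `ℝ²`. -/
def DiffeoAnnulus (R : Set (Fin 2 → ℝ)) : Prop :=
  ∃ r₁ r₂ : ℝ, 0 < r₁ ∧ r₁ < r₂ ∧ ∃ f g : (Fin 2 → ℝ) → (Fin 2 → ℝ),
    ContDiffOn ℝ ∞ f R ∧ ContDiffOn ℝ ∞ g (annulus r₁ r₂) ∧
    Set.MapsTo f R (annulus r₁ r₂) ∧ Set.MapsTo g (annulus r₁ r₂) R ∧
    Set.InvOn g f R (annulus r₁ r₂)

/-- `R` is a racetrack, `Q` is a racetrack vector field with racetrack `R`, and `m` is its lap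
time. -/
structure IsRacetrack (R : Set (Fin 2 → ℝ)) (Q : (Fin 2 → ℝ) → (Fin 2 → ℝ)) (m : ℤ) : Prop where
  isOpen : IsOpen R
  diffeoAnnulus : DiffeoAnnulus R
  track_subset : straight ∪ startLine ∪ checkpoint ⊆ R
  subset_cube : R ⊆ cube 2 (dilate 50 I₀)
  smooth : ContDiff ℝ ∞ Q
  bounded : ∀ v, Q v ∈ cube 2 (closure I₀)
  invariant : ∀ v ∈ R, ∀ t, flow Q t v ∈ R
  eq_on_straight : ∀ v ∈ straight, Q v = Q₀ v
  eq_off_cube : ∀ v, v ∉ cube 2 (dilate 50 I₀) → Q v = Q₀ v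
  lt_lap : 24 < m
  periodic : ∀ v ∈ R, flow Q m v = v
  mem_straight_iff : ∀ v ∈ startLine, ∀ t ∈ Set.Ioo (0 : ℝ) m, (flow Q t v ∈ straight ↔ t < 24)

/-! ### The pair `(P₀, K₀)` -/

/-- The first two coordinates of a point of `ℝ⁴`. -/
def proj12 (ρ : Fin 4 → ℝ) : Fin 2 → ℝ := ![ρ 0, ρ 1]

/-- The last two coordinates of a point of `ℝ⁴`. -/
def proj34 (ρ : Fin 4 → ℝ) : Fin 2 → ℝ := ![ρ 2, ρ 3]

/-- The point `(u, v)` of `ℝ² × ℝ² = ℝ⁴`. -/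
def pair (u v : Fin 2 → ℝ) : Fin 4 → ℝ := ![u 0, u 1, v 0, v 1]

/-- `α(y, z) = 1 - ζ_{3I₀}(y) ζ_{3I₀}(z)`. -/
def alpha (ζ : ℝ → ℝ) (v : Fin 2 → ℝ) : ℝ :=
  1 - plateau ζ (dilate 3 I₀) (v 0) * plateau ζ (dilate 3 I₀) (v 1)

/-- `P_*(u, v) = (α(v) H(u), Q(v))`. -/
def PStar (ζ : ℝ → ℝ) (c₀ : (Fin 2 → ℝ) → ℝ) (Q : (Fin 2 → ℝ) → (Fin 2 → ℝ))
    (ρ : Fin 4 → ℝ) : Fin 4 → ℝ :=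
  pair (alpha ζ (proj34 ρ) • hyp c₀ (proj12 ρ)) (Q (proj34 ρ))

/-- `X(u, v) = (H(u), Q₀(v))`. -/
def fieldX (c₀ : (Fin 2 → ℝ) → ℝ) (ρ : Fin 4 → ℝ) : Fin 4 → ℝ :=
  pair (hyp c₀ (proj12 ρ)) (Q₀ (proj34 ρ))

/-- `P_+ = β P_* + (1 - β) X`. -/
def PPlus (ζ : ℝ → ℝ) (c₀ : (Fin 2 → ℝ) → ℝ) (Q : (Fin 2 → ℝ) → (Fin 2 → ℝ))
    (β : (Fin 4 → ℝ) → ℝ) (ρ : Fin 4 → ℝ) : Fin 4 → ℝ :=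
  β ρ • PStar ζ c₀ Q ρ + (1 - β ρ) • fieldX c₀ ρ

/-- `P₀ = γ P_+ + (1 - γ) V₀`. -/
def P₀ (ζ : ℝ → ℝ) (c₀ : (Fin 2 → ℝ) → ℝ) (Q : (Fin 2 → ℝ) → (Fin 2 → ℝ))
    (β γ : (Fin 4 → ℝ) → ℝ) (ρ : Fin 4 → ℝ) : Fin 4 → ℝ :=
  γ ρ • PPlus ζ c₀ Q β ρ + (1 - γ ρ) • V₀ ρ

/-- `K₀ = 400 I₀`. -/
def K₀ : Set ℝ := dilate 400 I₀

end WaterPump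

end

/-!
Write `ρ = (w, x, y, z)`. The first two components of `P₀ ρ` are `r(ρ) (w, -x)` with a rate
`0 ≤ r ≤ c₀(w, x)`. Along a trajectory `|w|` therefore never decreases, `|x|` never increases, and
`|w|` grows at most like `eᵗ`. Where all coordinates are at most `100` in absolute value, the
cutoff functions are `1` and the last two components of `P₀` are the racetrack field `Q`, which
keeps the racetrack inside `(-50, 50)²`. Hence, if a trajectory starts over the racetrack and `|w|`
is small at time `t`, then it was small up to time `t`, and the last two components have followed
the flow of `Q` up to time `t` (`proj34_flow_P₀`).

Returning to the cube: a point of the bottom face moves straight up until time `2`. If it is in the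
cube at a later time `t < m`, then `|w| < 1` at time `t`, so that the last two components are those
of a `Q`-trajectory, which would be back in `(-1, 1)²` before the end of the lap; the hypotheses on
the racetrack exclude this (`flow_racetrack_notMem`, `flow_P₀_mem_cube_iff`).

Agreement with the identity: near `ξ` the last two components return exactly after the lap time
`m`, and the first two move with speed at most `c₀`, which is flat at the origin. So
`Φ_m(ρ) - ρ` is smaller than every power of `‖ρ - ξ‖` (`isBigO_flow_P₀_sub_id`). Since `Φ_m` is
smooth, all derivatives of `Φ_m - id` at `ξ` vanish (`iteratedFDeriv_eq_zero_of_isBigO`): a smooth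
map that is smaller than every power of the distance has a derivative with the same property.

Smoothness of `Φ_m` (`contDiff_flow`): a trajectory `γ` over a short interval `[0, T]` solves
`γ - ∫ P₀ ∘ γ = const ρ` in the Banach space of continuous curves. The superposition operator
`γ ↦ P₀ ∘ γ` is smooth (`contDiff_superpose`), and the linearized equation is a perturbation of
the identity of norm less than `1`, because `P₀` is globally Lipschitz; the inverse function theorem
applies (`contDiff_of_sub_comp_eq`). Long times are reached by iteration.
-/

open scoped ContDiff Topology Manifold

namespace WaterPump

/-! ### Superposition operators -/

/-- The superposition operator `γ ↦ f ∘ γ` on continuous maps from a fixed space. -/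
def superpose {K E F : Type*} [TopologicalSpace K] [TopologicalSpace E] [TopologicalSpace F]
    (f : E → F) (hf : Continuous f) (γ : C(K, E)) : C(K, F) :=
  ContinuousMap.comp ⟨f, hf⟩ γ

section Superposition

variable {K : Type*} [TopologicalSpace K] [CompactSpace K]
  {E F : Type*} [NormedAddCommGroup E] [NormedSpace ℝ E] [NormedAddCommGroup F] [NormedSpace ℝ F]

/-- Pointwise application `(A, h) ↦ (k ↦ A k (h k))` as a continuous bilinear map. -/
noncomputable def pointwiseApply (K E F : Type*) [TopologicalSpace K] [CompactSpace K]
    [NormedAddCommGroup E] [NormedSpace ℝ E] [NormedAddCommGroup F] [NormedSpace ℝ F] :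
    C(K, E →L[ℝ] F) →L[ℝ] C(K, E) →L[ℝ] C(K, F) :=
  LinearMap.mkContinuous₂
    (LinearMap.mk₂ ℝ
      (fun (A : C(K, E →L[ℝ] F)) (h : C(K, E)) => (⟨fun k => A k (h k), by fun_prop⟩ : C(K, F)))
      (fun _ _ _ => by ext; simp) (fun _ _ _ => by ext; simp)
      (fun _ _ _ => by ext; simp) (fun _ _ _ => by ext; simp)) 1
    (fun A h => by
      rw [one_mul]
      refine (ContinuousMap.norm_le _ (by positivity)).2 fun k => ?_
      exact (A k).le_of_opNorm_le_of_le (A.norm_coe_le_norm k) (h.norm_coe_le_norm k))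

theorem hasFDerivAt_superpose {f : E → F} (hf : ContDiff ℝ 1 f) (γ : C(K, E)) :
    HasFDerivAt (superpose f hf.continuous)
      (pointwiseApply K E F
        (superpose (fderiv ℝ f) (hf.continuous_fderiv one_ne_zero) γ)) γ := by
  rw [hasFDerivAt_iff_isLittleO_nhds_zero, Asymptotics.isLittleO_iff]
  intro ε hε
  -- the superposition operator of the derivative is continuous, which makes the estimate uniform
  have hcont : Continuous (superpose (K := K) (fderiv ℝ f) (hf.continuous_fderiv one_ne_zero)) :=
    ContinuousMap.continuous_postcomp _
  obtain ⟨δ, hδ, hball⟩ := (Metric.continuous_iff (α := C(K, E))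
    (β := C(K, E →L[ℝ] F))).1 hcont γ ε hε
  filter_upwards [Metric.ball_mem_nhds (0 : C(K, E)) hδ] with h hh
  rw [mem_ball_zero_iff] at hh
  refine (ContinuousMap.norm_le _ (by positivity)).2 fun k => ?_
  have key := Convex.norm_image_sub_le_of_norm_fderiv_le' (𝕜 := ℝ) (f := f) (C := ε)
    (s := segment ℝ (γ k) (γ k + h k)) (x := γ k) (y := γ k + h k) (φ := fderiv ℝ f (γ k))
    (fun x _ => hf.differentiable one_ne_zero x) ?_ (convex_segment _ _)
    (left_mem_segment _ _ _) (right_mem_segment _ _ _)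
  · rw [add_sub_cancel_left] at key
    exact key.trans (mul_le_mul_of_nonneg_left (h.norm_coe_le_norm k) hε.le)
  · intro x hx
    rw [segment_eq_image'] at hx
    obtain ⟨s, ⟨hs0, hs1⟩, rfl⟩ := hx
    have hlt : dist (γ + s • h) γ < δ := by
      rw [dist_eq_norm, add_sub_cancel_left, norm_smul, Real.norm_of_nonneg hs0]
      exact (mul_le_of_le_one_left (norm_nonneg _) hs1).trans_lt hh
    have h1 := (ContinuousMap.dist_lt_iff hε).1 (hball _ hlt) k
    rw [dist_eq_norm] at h1
    simpa [superpose] using h1.le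

/-- The superposition operator of a smooth map is smooth: its derivative is again built from a
superposition operator, that of the derivative. -/
theorem contDiff_superpose {K : Type*} [TopologicalSpace K] [CompactSpace K] {E F : Type}
    [NormedAddCommGroup E] [NormedSpace ℝ E] [NormedAddCommGroup F] [NormedSpace ℝ F]
    {f : E → F} (hf : ContDiff ℝ ∞ f) :
    ContDiff ℝ ∞ (superpose (K := K) f hf.continuous) := by
  rw [contDiff_infty]
  intro n
  induction n generalizing F with
  | zero => exact contDiff_zero.2 (ContinuousMap.continuous_postcomp _)
  | succ n ih =>
    have h1 : ContDiff ℝ 1 f := hf.of_le (by exact_mod_cast le_top)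
    have hf' : ContDiff ℝ ∞ (fderiv ℝ f) := hf.fderiv_right (m := ∞) le_rfl
    have hder := fun γ : C(K, E) => hasFDerivAt_superpose h1 γ
    refine contDiff_succ_iff_fderiv.2 ⟨fun γ => (hder γ).differentiableAt,
      fun h => absurd h (WithTop.natCast_ne_top n), ?_⟩
    rw [show fderiv ℝ (superpose (K := K) f hf.continuous) = fun γ => _ from
      funext fun γ => (hder γ).fderiv]
    exact (pointwiseApply K E F).contDiff.comp (ih hf')

theorem lipschitzWith_superpose {K E : Type*} [TopologicalSpace K] [CompactSpace K]
    [NormedAddCommGroup E] {f : E → E}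
    {k : NNReal} (hk : LipschitzWith k f) :
    LipschitzWith k (superpose (K := K) f hk.continuous) := by
  refine LipschitzWith.of_dist_le_mul fun γ δ =>
    (ContinuousMap.dist_le (by positivity)).2 fun t => ?_
  exact (hk.dist_le_mul (γ t) (δ t)).trans
    (mul_le_mul_of_nonneg_left (ContinuousMap.dist_apply_le_dist t) k.2)

end Superposition

/-! ### The Volterra operator -/

section Volterra

variable {E : Type*} [NormedAddCommGroup E] [NormedSpace ℝ E]

/-- The Volterra operator `γ ↦ (t ↦ ∫₀ᵗ γ)` on the continuous curves over `[0, T]`. -/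
noncomputable def volterra {T : ℝ} (hT : 0 ≤ T) :
    C(Set.Icc 0 T, E) →L[ℝ] C(Set.Icc 0 T, E) :=
  LinearMap.mkContinuous
    { toFun := fun γ => ⟨fun t => ∫ s in (0 : ℝ)..t, Set.IccExtend hT γ s,
        (intervalIntegral.continuous_primitive
          (fun _ _ => (γ.continuous.Icc_extend' (h := hT)).intervalIntegrable _ _) 0).comp
          continuous_subtype_val⟩
      map_add' := fun γ δ => by
        ext t
        exact intervalIntegral.integral_add
          ((γ.continuous.Icc_extend' (h := hT)).intervalIntegrable _ _)
          ((δ.continuous.Icc_extend' (h := hT)).intervalIntegrable _ _)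
      map_smul' := fun c γ => by
        ext t
        exact intervalIntegral.integral_smul c _ } T
    (fun γ => by
      refine (ContinuousMap.norm_le _ (by positivity)).2 fun t => ?_
      refine (intervalIntegral.norm_integral_le_of_norm_le_const (C := ‖γ‖)
        fun s _ => γ.norm_coe_le_norm _).trans ?_
      rw [sub_zero, abs_of_nonneg t.2.1, mul_comm]
      exact mul_le_mul_of_nonneg_right t.2.2 (norm_nonneg _))

theorem volterra_apply {T : ℝ} (hT : 0 ≤ T) (γ : C(Set.Icc 0 T, E)) (t : Set.Icc 0 T) :
    volterra hT γ t = ∫ s in (0 : ℝ)..t, Set.IccExtend hT γ s := rfl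

theorem norm_volterra_le {T : ℝ} (hT : 0 ≤ T) :
    ‖(volterra hT : C(Set.Icc 0 T, E) →L[ℝ] C(Set.Icc 0 T, E))‖ ≤ T :=
  LinearMap.mkContinuous_norm_le _ hT _

end Volterra

/-! ### Smooth dependence on the initial point -/

section SmoothDependence

variable {E : Type} [NormedAddCommGroup E] [NormedSpace ℝ E] [CompleteSpace E]

/-- The integral equation `γ - ∫ f ∘ γ = const x` of the initial value problem. -/
theorem sub_volterra_superpose_eq_const {f : E → E} (hf : Continuous f) {T : ℝ} (hT : 0 ≤ T)
    {γ : ℝ → E} (hγ : ∀ t, HasDerivAt γ (f (γ t)) t) (c : C(Set.Icc 0 T, E))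
    (hc : ∀ t, c t = γ t) :
    c - volterra hT (superpose f hf c) = ContinuousMap.const _ (γ 0) := by
  ext t
  have hγc : Continuous γ := continuous_iff_continuousAt.2 fun t => (hγ t).continuousAt
  have h1 : volterra hT (superpose f hf c) t = ∫ s in (0 : ℝ)..t, f (γ s) := by
    rw [volterra_apply]
    refine intervalIntegral.integral_congr fun s hs => ?_
    rw [Set.uIcc_of_le t.2.1] at hs
    have hs' : s ∈ Set.Icc 0 T := ⟨hs.1, hs.2.trans t.2.2⟩
    rw [Set.IccExtend_of_mem hT _ hs']
    simp [superpose, hc]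
  have h2 := intervalIntegral.integral_eq_sub_of_hasDerivAt (f := γ) (a := 0) (b := t)
    (fun s _ => hγ s) ((hf.comp hγc).intervalIntegrable _ _)
  rw [ContinuousMap.sub_apply, h1, h2, hc]
  simp

/-- The inverse function theorem for a nonlinear perturbation of the identity: the solution `c y` of
`c - J (N c) = ℓ y` depends smoothly on `y` when `J ∘ N` is a contraction. -/
theorem contDiff_of_sub_comp_eq {X Y : Type*} [NormedAddCommGroup X] [NormedSpace ℝ X]
    [CompleteSpace X] [NormedAddCommGroup Y] [NormedSpace ℝ Y] {N : X → X} (hN : ContDiff ℝ ∞ N)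
    {k : NNReal} (hk : LipschitzWith k N) {J : X →L[ℝ] X} (hJ : ‖J‖ * k < 1) (ℓ : Y →L[ℝ] X)
    {c : Y → X} (hc : ∀ y, c y - J (N (c y)) = ℓ y) : ContDiff ℝ ∞ c := by
  set G : X → X := fun γ => γ - J (N γ)
  have hG : ContDiff ℝ ∞ G := contDiff_id.sub (J.contDiff.comp hN)
  have hinj : Function.Injective G := by
    intro γ δ h
    have h1 : γ - δ = J (N γ - N δ) := by
      rw [map_sub]; exact sub_eq_sub_iff_sub_eq_sub.1 h
    have h2 : ‖N γ - N δ‖ ≤ k * ‖γ - δ‖ := by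
      have := hk.dist_le_mul γ δ
      rwa [dist_eq_norm, dist_eq_norm] at this
    have h3 : ‖γ - δ‖ ≤ ‖J‖ * (k * ‖γ - δ‖) := by
      conv_lhs => rw [h1]
      exact J.le_of_opNorm_le_of_le le_rfl h2
    have h4 : ‖γ - δ‖ = 0 := by nlinarith [norm_nonneg (γ - δ)]
    exact sub_eq_zero.1 (norm_eq_zero.1 h4)
  rw [contDiff_iff_contDiffAt]
  intro y₀
  have hA : ‖J.comp (fderiv ℝ N (c y₀))‖ < 1 :=
    ((J.opNorm_comp_le _).trans (mul_le_mul_of_nonneg_left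
      (norm_fderiv_le_of_lipschitz ℝ hk) (norm_nonneg J))).trans_lt hJ
  let e : X ≃L[ℝ] X := ContinuousLinearEquiv.unitsEquiv ℝ _ (Units.oneSub _ hA)
  have hder : HasFDerivAt G (e : X →L[ℝ] X) (c y₀) :=
    (hasFDerivAt_id _).sub (J.hasFDerivAt.comp _ (hN.differentiable (by simp) _).hasFDerivAt)
  have hGat := hG.contDiffAt (x := c y₀)
  have hloc := hGat.to_localInverse hder (by simp)
  have hright := (hGat.hasStrictFDerivAt' hder (by simp)).eventually_right_inverse
  have hGc : G (c y₀) = ℓ y₀ := hc y₀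
  rw [hGc] at hloc hright
  refine (hloc.comp y₀ ℓ.contDiff.contDiffAt).congr_of_eventuallyEq ?_
  filter_upwards [ℓ.continuous.continuousAt.eventually hright] with y hy
  exact (hinj (hy.trans (hc y).symm)).symm

/-- For short times the solution of an initial value problem depends smoothly on the initial
point, because it solves an integral equation in a space of curves. -/
theorem contDiff_shortTime {f : E → E} (hf : ContDiff ℝ ∞ f) {k : NNReal}
    (hk : LipschitzWith k f) {T : ℝ} (hT : 0 ≤ T) (hTk : T * k < 1) {φ : E → ℝ → E}
    (h0 : ∀ x, φ x 0 = x) (hφ : ∀ x t, HasDerivAt (φ x) (f (φ x t)) t) :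
    ContDiff ℝ ∞ (fun x => φ x T) := by
  have hφc : ∀ x, Continuous (φ x) := fun x =>
    continuous_iff_continuousAt.2 fun t => (hφ x t).continuousAt
  let c : E → C(Set.Icc 0 T, E) := fun x => ⟨fun t => φ x t, (hφc x).comp continuous_subtype_val⟩
  let ℓ : E →L[ℝ] C(Set.Icc 0 T, E) :=
    { toFun := fun x => ContinuousMap.const (Set.Icc 0 T) x
      map_add' := fun _ _ => rfl
      map_smul' := fun _ _ => rfl
      cont := ContinuousMap.continuous_const' }
  have hc : ContDiff ℝ ∞ c := by
    refine contDiff_of_sub_comp_eq (contDiff_superpose hf) (lipschitzWith_superpose hk)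
      (J := volterra hT) ?_ ℓ fun x => ?_
    · exact (mul_le_mul_of_nonneg_right (norm_volterra_le hT) k.2).trans_lt hTk
    · have := sub_volterra_superpose_eq_const hf.continuous hT (hφ x) (c x) (fun t => rfl)
      rwa [h0] at this
  exact (ContinuousMap.evalCLM ℝ (⟨T, hT, le_rfl⟩ : Set.Icc 0 T)).contDiff.comp hc

end SmoothDependence

/-! ### Flows of bounded vector fields -/

section Complete

variable {d : ℕ} {V : (Fin d → ℝ) → (Fin d → ℝ)}

/-- A bounded vector field of class `C¹` is complete: by the Picard-Lindelöf theorem there are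
solutions over `(-T, T)` for every `T`. -/
theorem exists_integralCurve (hV : ContDiff ℝ 1 V) (hb : ∀ x, ‖V x‖ ≤ 1) (x : Fin d → ℝ) :
    ∃ γ : ℝ → (Fin d → ℝ), γ 0 = x ∧ ∀ s, HasDerivAt γ (V (γ s)) s := by
  have hM : ContMDiff 𝓘(ℝ, Fin d → ℝ) 𝓘(ℝ, Fin d → ℝ).tangent 1
      (fun x => (⟨x, V x⟩ : TangentBundle 𝓘(ℝ, Fin d → ℝ) (Fin d → ℝ))) :=
    contMDiff_vectorSpace_iff_contDiff.2 hV
  obtain ⟨γ, h0, hγ⟩ := (exists_isMIntegralCurve_iff_exists_isMIntegralCurveOn_Ioo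
      (I := 𝓘(ℝ, Fin d → ℝ)) (M := Fin d → ℝ) (v := V) hM x).2 (fun a => by
    obtain ⟨K, hK⟩ := (hV.locallyLipschitz.locallyLipschitzOn
      (s := Metric.closedBall x |a|)).exists_lipschitzOnWith_of_compact
        (isCompact_closedBall x |a|)
    have h0 : (0 : ℝ) ∈ Set.Icc (-|a|) |a| := ⟨by simp, abs_nonneg a⟩
    obtain ⟨α, hα0, hα⟩ := (IsPicardLindelof.of_time_independent (f := V) (t₀ := ⟨0, h0⟩)
      (x₀ := x) (a := ⟨|a|, abs_nonneg a⟩) (r := 0) (L := 1) (fun y _ => hb y) hK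
      (by
        change ((1 : NNReal) : ℝ) * max (|a| - 0) (0 - -|a|) ≤ |a| - ((0 : NNReal) : ℝ)
        simp)).exists_eq_forall_mem_Icc_hasDerivWithinAt₀
    refine ⟨α, hα0, fun t ht => ?_⟩
    have ht' : t ∈ Set.Ioo (-|a|) |a| :=
      ⟨by linarith [ht.1, le_abs_self a], ht.2.trans_le (le_abs_self a)⟩
    exact ((hα t (Set.Ioo_subset_Icc_self ht')).hasDerivAt
      (Icc_mem_nhds ht'.1 ht'.2)).hasFDerivAt.hasMFDerivAt.hasMFDerivWithinAt)
  refine ⟨γ, h0, fun s => ?_⟩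
  have h : HasFDerivAt γ ((1 : ℝ →L[ℝ] ℝ).smulRight (V (γ s))) s :=
    hasMFDerivAt_iff_hasFDerivAt.1 (hγ s)
  simpa using h.hasDerivAt

theorem flow_zero (hV : ContDiff ℝ ∞ V) (hb : ∀ x, ‖V x‖ ≤ 1) (x : Fin d → ℝ) :
    flow V 0 x = x := by
  obtain ⟨γ, rfl, hγ⟩ := exists_integralCurve (hV.of_le (by exact_mod_cast le_top)) hb x
  exact flow_eq hV hγ 0

theorem hasDerivAt_flow (hV : ContDiff ℝ ∞ V) (hb : ∀ x, ‖V x‖ ≤ 1) (x : Fin d → ℝ) (t : ℝ) :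
    HasDerivAt (fun s => flow V s x) (V (flow V t x)) t := by
  obtain ⟨γ, rfl, hγ⟩ := exists_integralCurve (hV.of_le (by exact_mod_cast le_top)) hb x
  simp_rw [flow_eq hV hγ]
  exact hγ t

theorem flow_add (hV : ContDiff ℝ ∞ V) (hb : ∀ x, ‖V x‖ ≤ 1) (x : Fin d → ℝ) (s t : ℝ) :
    flow V (s + t) x = flow V s (flow V t x) := by
  have h := flow_eq hV (γ := fun r => flow V (r + t) x)
    (fun r => (hasDerivAt_flow hV hb x (r + t)).comp_add_const r t) s
  simpa using h.symm

/-- The flow of a smooth, bounded and Lipschitz vector field is smooth at each time: it is an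
iterate of the flow for a short time. -/
theorem contDiff_flow (hV : ContDiff ℝ ∞ V) (hb : ∀ x, ‖V x‖ ≤ 1) {k : NNReal}
    (hk : LipschitzWith k V) {t : ℝ} (ht : 0 ≤ t) : ContDiff ℝ ∞ (flow V t) := by
  obtain ⟨n, hn⟩ := exists_nat_gt (t * k)
  have hn0 : (0 : ℝ) < n := lt_of_le_of_lt (by positivity) hn
  have hs : ContDiff ℝ ∞ (flow V (t / n)) := by
    refine contDiff_shortTime hV hk (by positivity) ?_ (φ := fun x s => flow V s x)
      (flow_zero hV hb) (hasDerivAt_flow hV hb)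
    rw [div_mul_eq_mul_div, div_lt_one hn0]
    exact hn
  have hit : ∀ j : ℕ, ContDiff ℝ ∞ (flow V (j * (t / n))) := by
    intro j
    induction j with
    | zero =>
      rw [show flow V (((0 : ℕ) : ℝ) * (t / n)) = id from
        funext fun x => by simpa using flow_zero hV hb x]
      exact contDiff_id
    | succ j ih =>
      rw [show flow V (((j + 1 : ℕ) : ℝ) * (t / n)) =
          flow V (j * (t / n)) ∘ flow V (t / n) from
        funext fun x => by
          rw [Function.comp_apply, ← flow_add hV hb]; congr 1; push_cast; ring]
      exact ih.comp hs
  have := hit n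
  rwa [mul_div_cancel₀ t hn0.ne'] at this

end Complete

/-! ### Flatness and rates of decay -/

/-- A map that vanishes at `x` faster than every power of the distance has a derivative with the
same property: the difference quotient at `y` with step `‖y - x‖ ^ (N + 1)` approximates the
derivative at `y` up to a multiple of the step. -/
theorem isBigO_fderiv_of_isBigO {E F : Type*} [NormedAddCommGroup E] [NormedSpace ℝ E]
    [NormedAddCommGroup F] [NormedSpace ℝ F] {f : E → F} {x : E} (hf : ContDiffAt ℝ 2 f x)
    (hO : ∀ N : ℕ, f =O[𝓝 x] fun y => ‖y - x‖ ^ N) (N : ℕ) :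
    fderiv ℝ f =O[𝓝 x] fun y => ‖y - x‖ ^ N := by
  obtain ⟨C, t, ht, hC⟩ := (hf.fderiv_right (m := 1) (by norm_num)).exists_lipschitzOnWith
  obtain ⟨A, hA0, hA⟩ := (hO (2 * (N + 1))).exists_nonneg
  rw [Asymptotics.isBigOWith_iff] at hA
  have hd : ∀ᶠ y in 𝓝 x, DifferentiableAt ℝ f y :=
    (hf.eventually (by simp)).mono fun y hy => hy.differentiableAt two_ne_zero
  obtain ⟨r, hr, hball⟩ := Metric.eventually_nhds_iff_ball.1 ((hd.and hA).and ht)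
  refine Asymptotics.IsBigO.of_bound (A * (2 ^ (2 * (N + 1)) + 1) + C) ?_
  filter_upwards [Metric.ball_mem_nhds x (lt_min (half_pos hr) one_pos)] with y hy
  set δ := ‖y - x‖ with hδ
  rw [mem_ball_iff_norm, ← hδ] at hy
  have hδr : δ < r / 2 := hy.trans_le (min_le_left _ _)
  have hδ1 : δ ≤ 1 := (hy.trans_le (min_le_right _ _)).le
  have hδ0 : 0 ≤ δ := norm_nonneg _
  rcases hδ0.eq_or_lt with h0 | hpos
  · have hyx : y = x := sub_eq_zero.1 (norm_eq_zero.1 h0.symm)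
    rw [hyx, ((hO 2).hasFDerivAt one_lt_two).fderiv, norm_zero]
    positivity
  set s := δ ^ (N + 1) with hs
  have hs0 : 0 < s := by positivity
  have hsδ : s ≤ δ := by
    rw [hs, pow_succ]; exact mul_le_of_le_one_left hδ0 (pow_le_one₀ hδ0 hδ1)
  have hsN : s ≤ δ ^ N := pow_le_pow_of_le_one hδ0 hδ1 (Nat.le_succ N)
  have hmem : ∀ z ∈ Metric.closedBall y s, z ∈ Metric.ball x r := fun z hz => by
    rw [mem_closedBall_iff_norm] at hz
    rw [mem_ball_iff_norm]
    calc ‖z - x‖ = ‖(z - y) + (y - x)‖ := by rw [sub_add_sub_cancel]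
      _ ≤ s + δ := (norm_add_le _ _).trans (add_le_add_left hz _)
      _ < r := by linarith
  have hyy : y ∈ Metric.closedBall y s := Metric.mem_closedBall_self hs0.le
  refine ContinuousLinearMap.opNorm_le_of_unit_norm (by positivity) fun v hv => ?_
  have hsv : ‖s • v‖ = s := by rw [norm_smul, hv, mul_one, Real.norm_of_nonneg hs0.le]
  have hzz : y + s • v ∈ Metric.closedBall y s := by
    rw [mem_closedBall_iff_norm, add_sub_cancel_left, hsv]
  have key := Convex.norm_image_sub_le_of_norm_fderiv_le' (𝕜 := ℝ) (f := f) (C := C * s)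
    (φ := fderiv ℝ f y) (fun z hz => (hball z (hmem z hz)).1.1) (fun z hz => by
      have := hC.dist_le_mul z (hball z (hmem z hz)).2 y (hball y (hmem y hyy)).2
      rw [dist_eq_norm, dist_eq_norm] at this
      exact this.trans (mul_le_mul_of_nonneg_left (mem_closedBall_iff_norm.1 hz) C.2))
    (convex_closedBall y s) hyy hzz
  rw [add_sub_cancel_left, hsv, map_smul] at key
  have hfy : ‖f y‖ ≤ A * s ^ 2 := by
    have := (hball y (hmem y hyy)).1.2
    rw [norm_pow, norm_norm, ← hδ] at this
    rwa [hs, ← pow_mul, mul_comm (N + 1)]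
  have hfz : ‖f (y + s • v)‖ ≤ A * (2 ^ (2 * (N + 1)) * s ^ 2) := by
    refine (hball _ (hmem _ hzz)).1.2.trans (mul_le_mul_of_nonneg_left ?_ hA0)
    rw [norm_pow, norm_norm, hs, ← pow_mul, mul_comm (N + 1), ← mul_pow]
    refine pow_le_pow_left₀ (norm_nonneg _) ?_ _
    calc ‖y + s • v - x‖ = ‖(y - x) + s • v‖ := by congr 1; abel
      _ ≤ δ + s := (norm_add_le _ _).trans_eq (by rw [hsv])
      _ ≤ 2 * δ := by linarith
  have h1 : ‖s • fderiv ℝ f y v‖ ≤ (A * (2 ^ (2 * (N + 1)) + 1) + C) * s * s := by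
    have : s • fderiv ℝ f y v =
        f (y + s • v) - f y - (f (y + s • v) - f y - s • fderiv ℝ f y v) := by
      abel
    rw [this]
    refine (norm_sub_le _ _).trans ((add_le_add (norm_sub_le _ _) key).trans ?_)
    nlinarith
  rw [norm_smul, Real.norm_of_nonneg hs0.le, mul_comm] at h1
  refine (le_of_mul_le_mul_right h1 hs0).trans ?_
  rw [norm_pow, norm_norm]
  exact mul_le_mul_of_nonneg_left hsN (by positivity)

theorem iteratedFDeriv_eq_zero_of_isBigO {E F : Type} [NormedAddCommGroup E] [NormedSpace ℝ E]
    [NormedAddCommGroup F] [NormedSpace ℝ F] {f : E → F} {x : E} (hf : ContDiffAt ℝ ∞ f x)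
    (hO : ∀ N : ℕ, f =O[𝓝 x] fun y => ‖y - x‖ ^ N) (k : ℕ) :
    iteratedFDeriv ℝ k f x = 0 := by
  induction k generalizing F with
  | zero =>
    have h0 : f x = 0 := by
      have := (hO 1).eq_zero_imp.self_of_nhds
      simpa using this
    ext m
    simpa using h0
  | succ k ih =>
    have := ih (hf.fderiv_right (m := ∞) le_rfl)
      (isBigO_fderiv_of_isBigO (contDiffAt_infty.1 hf 2) hO)
    rw [iteratedFDeriv_succ_eq_comp_right, Function.comp_apply, this,
      LinearIsometryEquiv.map_zero]

theorem isBigO_of_iteratedFDeriv_eq_zero {E F : Type} [NormedAddCommGroup E] [NormedSpace ℝ E]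
    [NormedAddCommGroup F] [NormedSpace ℝ F] {f : E → F} {x : E} (hf : ContDiffAt ℝ ∞ f x)
    (h0 : ∀ k : ℕ, iteratedFDeriv ℝ k f x = 0) (N : ℕ) :
    f =O[𝓝 x] fun y => ‖y - x‖ ^ N := by
  induction N generalizing F with
  | zero => simpa using hf.continuousAt.isBigO_one ℝ
  | succ N ih =>
    have hO := ih (hf.fderiv_right (m := ∞) le_rfl) fun k => by
      have := h0 (k + 1)
      rwa [iteratedFDeriv_succ_eq_comp_right, Function.comp_apply,
        LinearIsometryEquiv.map_eq_zero_iff] at this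
    have hfx : f x = 0 := by
      have := congrArg (fun L => L (fun _ => 0)) (h0 0)
      simpa using this
    obtain ⟨A, hA0, hA⟩ := hO.exists_nonneg
    rw [Asymptotics.isBigOWith_iff] at hA
    have hd : ∀ᶠ y in 𝓝 x, DifferentiableAt ℝ f y :=
      ((hf.of_le (m := 1) (by exact_mod_cast le_top)).eventually (by simp)).mono
        fun y hy => hy.differentiableAt one_ne_zero
    obtain ⟨r, hr, hball⟩ := Metric.eventually_nhds_iff_ball.1 (hd.and hA)
    refine Asymptotics.IsBigO.of_bound A ?_
    filter_upwards [Metric.ball_mem_nhds x hr] with y hy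
    rw [mem_ball_iff_norm] at hy
    have hmem : ∀ z ∈ Metric.closedBall x ‖y - x‖, z ∈ Metric.ball x r := fun z hz =>
      mem_ball_iff_norm.2 ((mem_closedBall_iff_norm.1 hz).trans_lt hy)
    have := Convex.norm_image_sub_le_of_norm_fderiv_le (𝕜 := ℝ) (f := f)
      (C := A * ‖y - x‖ ^ N) (fun z hz => (hball z (hmem z hz)).1) (fun z hz => by
        refine (hball z (hmem z hz)).2.trans (mul_le_mul_of_nonneg_left ?_ hA0)
        rw [norm_pow, norm_norm]
        exact pow_le_pow_left₀ (norm_nonneg _) (mem_closedBall_iff_norm.1 hz) _)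
      (convex_closedBall x ‖y - x‖) (Metric.mem_closedBall_self (norm_nonneg _))
      (mem_closedBall_iff_norm.2 le_rfl)
    rw [hfx, sub_zero, mul_assoc, ← pow_succ] at this
    rwa [norm_pow, norm_norm]

/-- Two maps that are smooth at a point and whose difference vanishes there faster than every
power of the distance agree to all orders. -/
theorem agreeToAllOrders_of_isBigO {E F : Type} [NormedAddCommGroup E] [NormedSpace ℝ E]
    [NormedAddCommGroup F] [NormedSpace ℝ F] {f g : E → F} {x : E} (hf : ContDiffAt ℝ ∞ f x)
    (hg : ContDiffAt ℝ ∞ g x) (hO : ∀ N : ℕ, (f - g) =O[𝓝 x] fun y => ‖y - x‖ ^ N) :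
    AgreeToAllOrders f g x := by
  refine ⟨hf, hg, fun k => ?_⟩
  have := iteratedFDeriv_eq_zero_of_isBigO (f := f - g) (hf.sub hg) hO k
  rwa [iteratedFDeriv_sub_apply (hf.of_le (by exact_mod_cast le_top))
    (hg.of_le (by exact_mod_cast le_top)), sub_eq_zero] at this

/-- A function that agrees with the zero function to all orders at a point vanishes there faster
than every power of the distance. -/
theorem AgreeToAllOrders.isBigO {E F : Type} [NormedAddCommGroup E] [NormedSpace ℝ E]
    [NormedAddCommGroup F] [NormedSpace ℝ F] {f : E → F} {x : E}
    (hf : AgreeToAllOrders f (fun _ => 0) x) (N : ℕ) : f =O[𝓝 x] fun y => ‖y - x‖ ^ N := by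
  refine isBigO_of_iteratedFDeriv_eq_zero hf.1 (fun k => ?_) N
  rw [hf.2.2 k, iteratedFDeriv_fun_zero]
  rfl

/-! ### Intervals and plateau functions -/

theorem halfLen_Ioo {a : ℝ} (ha : 0 < a) : halfLen (Set.Ioo (-a) a) = a :=
  csSup_Ioo (by linarith)

theorem halfLen_I₀ : halfLen I₀ = 1 := halfLen_Ioo one_pos

theorem dilate_I₀ (n : ℕ) : dilate n I₀ = Set.Ioo (-(n : ℝ)) n := by
  rw [dilate, halfLen_I₀, mul_one]

theorem closure_I₀ : closure I₀ = Set.Icc (-1) 1 := closure_Ioo (by norm_num)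

theorem closure_dilate_I₀ {n : ℕ} (hn : 0 < n) :
    closure (dilate n I₀) = Set.Icc (-(n : ℝ)) n := by
  have : (0 : ℝ) < n := by exact_mod_cast hn
  rw [dilate_I₀, closure_Ioo (by linarith)]

theorem norm_le_one_of_mem_cube {d : ℕ} {x : Fin d → ℝ} (hx : x ∈ cube d (closure I₀)) :
    ‖x‖ ≤ 1 := by
  rw [closure_I₀] at hx
  exact (pi_norm_le_iff_of_nonneg zero_le_one).2 fun i => abs_le.2 (hx i)

theorem convex_cube (d : ℕ) {S : Set ℝ} (hS : Convex ℝ S) : Convex ℝ (cube d S) :=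
  fun _ hx _ hy _ _ ha hb hab i => hS (hx i) (hy i) ha hb hab

theorem IsStep.mem_Icc {ζ : ℝ → ℝ} (hζ : IsStep ζ) (x : ℝ) : ζ x ∈ Set.Icc (0 : ℝ) 1 := by
  rcases le_or_gt x 0 with h0 | h0
  · rw [hζ.eq_one x h0]; simp
  rcases le_or_gt 1 x with h1 | h1
  · rw [hζ.eq_zero x h1]; simp
  have hanti : AntitoneOn ζ (Set.Icc 0 1) := by
    refine antitoneOn_of_deriv_nonpos (convex_Icc 0 1) hζ.smooth.continuous.continuousOn
      (hζ.smooth.differentiable (by simp)).differentiableOn fun y hy => ?_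
    rw [interior_Icc] at hy
    exact (hζ.deriv_neg y hy).le
  have hx : x ∈ Set.Icc (0 : ℝ) 1 := ⟨h0.le, h1.le⟩
  constructor
  · rw [← hζ.eq_zero 1 le_rfl]; exact hanti hx (Set.right_mem_Icc.2 zero_le_one) h1.le
  · rw [← hζ.eq_one 0 le_rfl]; exact hanti (Set.left_mem_Icc.2 zero_le_one) hx h0.le

section Plateau

variable {ζ : ℝ → ℝ} {I : Set ℝ}

theorem plateau_eq_one (hζ : IsStep ζ) {x : ℝ} (hx : |x| ≤ halfLen I) : plateau ζ I x = 1 := by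
  obtain ⟨h1, h2⟩ := abs_le.1 hx
  unfold plateau
  split_ifs
  · exact hζ.eq_one _ (by linarith)
  · exact hζ.eq_one _ (by linarith)

theorem plateau_mem_Icc (hζ : IsStep ζ) (x : ℝ) : plateau ζ I x ∈ Set.Icc (0 : ℝ) 1 := by
  unfold plateau
  split_ifs
  · exact hζ.mem_Icc _
  · exact hζ.mem_Icc _

theorem contDiff_plateau (hζ : IsStep ζ) (hI : 0 < halfLen I) : ContDiff ℝ ∞ (plateau ζ I) := by
  rw [contDiff_iff_contDiffAt]
  intro x
  rcases lt_trichotomy x 0 with hx | rfl | hx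
  · have h : ContDiffAt ℝ ∞ (fun y => ζ (-y - halfLen I)) x :=
      (hζ.smooth.comp (contDiff_neg.sub contDiff_const)).contDiffAt
    refine h.congr_of_eventuallyEq ?_
    filter_upwards [gt_mem_nhds hx] with y hy
    exact if_pos hy.le
  · refine (contDiffAt_const (c := (1 : ℝ))).congr_of_eventuallyEq ?_
    filter_upwards [Metric.ball_mem_nhds (0 : ℝ) hI] with y hy
    rw [mem_ball_zero_iff] at hy
    exact plateau_eq_one hζ hy.le
  · have h : ContDiffAt ℝ ∞ (fun y => ζ (y - halfLen I)) x :=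
      (hζ.smooth.comp (contDiff_id.sub contDiff_const)).contDiffAt
    refine h.congr_of_eventuallyEq ?_
    filter_upwards [lt_mem_nhds hx] with y hy
    exact if_neg hy.not_ge

theorem halfLen_dilate_three : halfLen (dilate 3 I₀) = 3 := by
  rw [dilate_I₀]; exact halfLen_Ioo (by norm_num)

theorem alpha_mem_Icc (hζ : IsStep ζ) (v : Fin 2 → ℝ) : alpha ζ v ∈ Set.Icc (0 : ℝ) 1 := by
  obtain ⟨h1, h2⟩ := plateau_mem_Icc (I := dilate 3 I₀) hζ (v 0)
  obtain ⟨h3, h4⟩ := plateau_mem_Icc (I := dilate 3 I₀) hζ (v 1)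
  exact ⟨sub_nonneg.2 (mul_le_one₀ h2 h3 h4), sub_le_self _ (mul_nonneg h1 h3)⟩

theorem contDiff_alpha (hζ : IsStep ζ) : ContDiff ℝ ∞ (alpha ζ) := by
  have h : ContDiff ℝ ∞ (plateau ζ (dilate 3 I₀)) :=
    contDiff_plateau hζ (by rw [halfLen_dilate_three]; norm_num)
  exact contDiff_const.sub ((h.comp (contDiff_apply ℝ ℝ 0)).mul (h.comp (contDiff_apply ℝ ℝ 1)))

end Plateau

/-! ### The splitting `ℝ⁴ = ℝ² × ℝ²` -/

section Coordinates

theorem proj34_pair (u v : Fin 2 → ℝ) : proj34 (pair u v) = v := by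
  ext i; fin_cases i <;> rfl

theorem pair_proj (ρ : Fin 4 → ℝ) : pair (proj12 ρ) (proj34 ρ) = ρ := by
  ext i; fin_cases i <;> rfl

theorem contDiff_proj12 : ContDiff ℝ ∞ proj12 :=
  contDiff_pi.2 fun i => by fin_cases i <;> exact contDiff_apply ℝ ℝ _

theorem contDiff_proj34 : ContDiff ℝ ∞ proj34 :=
  contDiff_pi.2 fun i => by fin_cases i <;> exact contDiff_apply ℝ ℝ _

theorem contDiff_pair {f g : (Fin 4 → ℝ) → (Fin 2 → ℝ)} (hf : ContDiff ℝ ∞ f)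
    (hg : ContDiff ℝ ∞ g) : ContDiff ℝ ∞ fun ρ => pair (f ρ) (g ρ) :=
  contDiff_pi.2 fun i => by
    fin_cases i
    · exact contDiff_pi.1 hf 0
    · exact contDiff_pi.1 hf 1
    · exact contDiff_pi.1 hg 0
    · exact contDiff_pi.1 hg 1

theorem pair_mem_cube {S : Set ℝ} {u v : Fin 2 → ℝ} (hu : u ∈ cube 2 S) (hv : v ∈ cube 2 S) :
    pair u v ∈ cube 4 S := fun i => by
  fin_cases i
  · exact hu 0
  · exact hu 1
  · exact hv 0
  · exact hv 1

theorem norm_proj34_sub_le (ρ σ : Fin 4 → ℝ) : ‖proj34 ρ - proj34 σ‖ ≤ ‖ρ - σ‖ :=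
  (pi_norm_le_iff_of_nonneg (norm_nonneg _)).2 fun i => by
    fin_cases i
    · exact norm_le_pi_norm (ρ - σ) 2
    · exact norm_le_pi_norm (ρ - σ) 3

theorem norm_pair_sub_pair_le (u v v' : Fin 2 → ℝ) : ‖pair u v - pair u v'‖ ≤ ‖v - v'‖ :=
  (pi_norm_le_iff_of_nonneg (norm_nonneg _)).2 fun i => by
    fin_cases i
    · simp [pair]
    · simp [pair]
    · exact norm_le_pi_norm (v - v') 0
    · exact norm_le_pi_norm (v - v') 1

theorem hasDerivAt_proj34 {f : ℝ → (Fin 4 → ℝ)} {f' : Fin 4 → ℝ} {t : ℝ}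
    (hf : HasDerivAt f f' t) : HasDerivAt (fun s => proj34 (f s)) (proj34 f') t :=
  hasDerivAt_pi.2 fun i => by
    fin_cases i
    · exact hasDerivAt_pi.1 hf 2
    · exact hasDerivAt_pi.1 hf 3

end Coordinates

/-! ### The field `P₀` -/

section Field

variable {ζ : ℝ → ℝ} {c₀ : (Fin 2 → ℝ) → ℝ} {Q : (Fin 2 → ℝ) → (Fin 2 → ℝ)}
  {β γ : (Fin 4 → ℝ) → ℝ}

theorem IsSlowing.mem_Icc (hc₀ : IsSlowing c₀) (u : Fin 2 → ℝ) : c₀ u ∈ Set.Icc (0 : ℝ) 1 := by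
  rcases eq_or_ne u 0 with rfl | hu
  · have h : c₀ 0 = 0 := by
      have := congrArg (fun L => L (fun _ => 0)) (hc₀.flat.2.2 0)
      simpa using this
    rw [h]; simp
  · exact Set.Ioo_subset_Icc_self (hc₀.mem_Ioo u hu)

theorem contDiff_hyp (hc₀ : IsSlowing c₀) : ContDiff ℝ ∞ (hyp c₀) := by
  have : ContDiff ℝ ∞ H₀ := contDiff_pi.2 fun i => by
    fin_cases i
    · exact contDiff_apply ℝ ℝ 0
    · exact (contDiff_apply ℝ ℝ 1).neg
  exact hc₀.smooth.smul this

theorem contDiff_P₀ (hζ : IsStep ζ) (hc₀ : IsSlowing c₀) (hQ : ContDiff ℝ ∞ Q)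
    (hβ : ContDiff ℝ ∞ β) (hγ : ContDiff ℝ ∞ γ) : ContDiff ℝ ∞ (P₀ ζ c₀ Q β γ) := by
  have hH := (contDiff_hyp hc₀).comp contDiff_proj12
  have hS : ContDiff ℝ ∞ (PStar ζ c₀ Q) :=
    contDiff_pair (((contDiff_alpha hζ).comp contDiff_proj34).smul hH) (hQ.comp contDiff_proj34)
  have hX : ContDiff ℝ ∞ (fieldX c₀) := contDiff_pair hH contDiff_const
  exact (hγ.smul ((hβ.smul hS).add ((contDiff_const.sub hβ).smul hX))).add
    ((contDiff_const.sub hγ).smul contDiff_const)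

theorem Q₀_mem_cube (v : Fin 2 → ℝ) : Q₀ v ∈ cube 2 (closure I₀) := by
  rw [closure_I₀]
  intro i
  fin_cases i <;> norm_num [Q₀]

theorem V₀_mem_cube (ρ : Fin 4 → ℝ) : V₀ ρ ∈ cube 4 (closure I₀) := by
  rw [closure_I₀]
  intro i
  fin_cases i <;> norm_num [V₀]

theorem P₀_mem_cube (hζ : IsStep ζ) (hc₀ : IsSlowing c₀) (hQ : ∀ v, Q v ∈ cube 2 (closure I₀))
    (hβ : ∀ ρ, β ρ ∈ Set.Icc (0 : ℝ) 1) (hγ : ∀ ρ, γ ρ ∈ Set.Icc (0 : ℝ) 1) (ρ : Fin 4 → ℝ) :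
    P₀ ζ c₀ Q β γ ρ ∈ cube 4 (closure I₀) := by
  have hI : Convex ℝ (closure I₀) := (convex_Ioo _ _).closure
  have h4 := convex_cube 4 hI
  have hα := alpha_mem_Icc hζ (proj34 ρ)
  have h0 : (0 : Fin 2 → ℝ) ∈ cube 2 (closure I₀) := by
    rw [closure_I₀]; intro i; simp
  have hαH : alpha ζ (proj34 ρ) • hyp c₀ (proj12 ρ) ∈ cube 2 (closure I₀) :=
    (convex_cube 2 hI).smul_mem_of_zero_mem h0 (hc₀.bounded _) hα
  exact h4 (h4 (pair_mem_cube hαH (hQ _)) (pair_mem_cube (hc₀.bounded _) (Q₀_mem_cube _))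
    (hβ ρ).1 (sub_nonneg.2 (hβ ρ).2) (by ring)) (V₀_mem_cube ρ) (hγ ρ).1
    (sub_nonneg.2 (hγ ρ).2) (by ring)

/-- The rate `r(u, v) = γ (β α(v) + 1 - β) c₀(u)` for which the first two components of
`P₀(u, v)` are `r(u, v) (w, -x)`, where `u = (w, x)`. -/
noncomputable def rate (ζ : ℝ → ℝ) (c₀ : (Fin 2 → ℝ) → ℝ) (β γ : (Fin 4 → ℝ) → ℝ)
    (ρ : Fin 4 → ℝ) : ℝ :=
  γ ρ * (β ρ * alpha ζ (proj34 ρ) + (1 - β ρ)) * c₀ (proj12 ρ)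

theorem P₀_apply_zero (ρ : Fin 4 → ℝ) : P₀ ζ c₀ Q β γ ρ 0 = rate ζ c₀ β γ ρ * ρ 0 := by
  simp [P₀, PPlus, PStar, fieldX, V₀, pair, hyp, H₀, rate, proj12]
  ring

theorem P₀_apply_one (ρ : Fin 4 → ℝ) : P₀ ζ c₀ Q β γ ρ 1 = -(rate ζ c₀ β γ ρ * ρ 1) := by
  simp [P₀, PPlus, PStar, fieldX, V₀, pair, hyp, H₀, rate, proj12]
  ring

theorem rate_nonneg_le (hζ : IsStep ζ) (hc₀ : IsSlowing c₀)
    (hβ : ∀ ρ, β ρ ∈ Set.Icc (0 : ℝ) 1) (hγ : ∀ ρ, γ ρ ∈ Set.Icc (0 : ℝ) 1) (ρ : Fin 4 → ℝ) :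
    0 ≤ rate ζ c₀ β γ ρ ∧ rate ζ c₀ β γ ρ ≤ c₀ (proj12 ρ) := by
  obtain ⟨hα0, hα1⟩ := alpha_mem_Icc hζ (proj34 ρ)
  obtain ⟨hβ0, hβ1⟩ := hβ ρ
  obtain ⟨hγ0, hγ1⟩ := hγ ρ
  have hc := (hc₀.mem_Icc (proj12 ρ)).1
  have h0 : 0 ≤ β ρ * alpha ζ (proj34 ρ) + (1 - β ρ) :=
    add_nonneg (mul_nonneg hβ0 hα0) (sub_nonneg.2 hβ1)
  have h1 : β ρ * alpha ζ (proj34 ρ) + (1 - β ρ) ≤ 1 := by nlinarith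
  exact ⟨mul_nonneg (mul_nonneg hγ0 h0) hc,
    mul_le_of_le_one_left hc (mul_le_one₀ hγ1 h0 h1)⟩

theorem mem_closed_cube {n : ℕ} (hn : 0 < n) {ρ : Fin 4 → ℝ} (h : ∀ i, |ρ i| ≤ n) :
    ρ ∈ cube 4 (closure (dilate n I₀)) := by
  rw [closure_dilate_I₀ hn]
  exact fun i => abs_le.1 (h i)

/-- Near the origin both cutoff functions are `1` and the last two components of `P₀` form the
racetrack field. -/
theorem P₀_eq_PStar (hβ : IsCutoff (dilate 100 I₀) (dilate 200 I₀) β)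
    (hγ : IsCutoff (dilate 300 I₀) (dilate 400 I₀) γ) {ρ : Fin 4 → ℝ} (h : ∀ i, |ρ i| ≤ 100) :
    P₀ ζ c₀ Q β γ ρ = PStar ζ c₀ Q ρ := by
  have h1 : β ρ = 1 := hβ.eq_one ρ (mem_closed_cube (by norm_num) (by exact_mod_cast h))
  have h2 : γ ρ = 1 := hγ.eq_one ρ (mem_closed_cube (by norm_num) fun i =>
    (h i).trans (by norm_num))
  simp [P₀, PPlus, h1, h2]

theorem P₀_eq_V₀_of_notMem (hγ : IsCutoff (dilate 300 I₀) (dilate 400 I₀) γ) {ρ : Fin 4 → ℝ}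
    (h : ρ ∉ cube 4 (dilate 400 I₀)) : P₀ ζ c₀ Q β γ ρ = V₀ ρ := by
  simp [P₀, hγ.eq_zero ρ h]

theorem P₀_eq_V₀_of_mem (hζ : IsStep ζ) (hβ : IsCutoff (dilate 100 I₀) (dilate 200 I₀) β)
    (hγ : IsCutoff (dilate 300 I₀) (dilate 400 I₀) γ) (hQ : ∀ v ∈ straight, Q v = Q₀ v)
    {ρ : Fin 4 → ℝ} (h : ∀ i, |ρ i| ≤ 3) : P₀ ζ c₀ Q β γ ρ = V₀ ρ := by
  have hα : alpha ζ (proj34 ρ) = 0 := by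
    rw [alpha, plateau_eq_one hζ, plateau_eq_one hζ]
    · norm_num
    · rw [halfLen_dilate_three]; exact h 3
    · rw [halfLen_dilate_three]; exact h 2
  have hst : proj34 ρ ∈ straight := by
    have h2 := abs_le.1 (h 2)
    have h3 := abs_le.1 (h 3)
    simp only [straight, dilate_I₀, Set.mem_ofPred_eq, Set.mem_Ioo, proj34, Matrix.cons_val_zero,
      Matrix.cons_val_one]
    norm_num
    refine ⟨⟨?_, ?_⟩, ?_, ?_⟩ <;> linarith
  rw [P₀_eq_PStar hβ hγ fun i => (h i).trans (by norm_num), PStar, hα, hQ _ hst]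
  ext i; fin_cases i <;> simp [pair, Q₀, V₀]

/-- `P₀` is globally Lipschitz because it differs from a constant field by a smooth field with
compact support. -/
theorem exists_lipschitzWith_P₀ (hζ : IsStep ζ) (hc₀ : IsSlowing c₀) (hQ : ContDiff ℝ ∞ Q)
    (hβ : IsCutoff (dilate 100 I₀) (dilate 200 I₀) β)
    (hγ : IsCutoff (dilate 300 I₀) (dilate 400 I₀) γ) :
    ∃ k, LipschitzWith k (P₀ ζ c₀ Q β γ) := by
  have hs : HasCompactSupport fun ρ => P₀ ζ c₀ Q β γ ρ - ![0, 0, 0, 1] := by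
    refine HasCompactSupport.intro (isCompact_closedBall 0 400) fun ρ hρ => ?_
    refine sub_eq_zero.2 (P₀_eq_V₀_of_notMem hγ fun hmem => hρ ?_)
    rw [dilate_I₀] at hmem
    rw [mem_closedBall_zero_iff]
    exact (pi_norm_le_iff_of_nonneg (by norm_num)).2 fun i =>
      abs_le.2 ⟨by exact_mod_cast (hmem i).1.le, by exact_mod_cast (hmem i).2.le⟩
  obtain ⟨k, hk⟩ := ContDiff.lipschitzWith_of_hasCompactSupport (𝕂 := ℝ) hs
    ((contDiff_P₀ hζ hc₀ hQ hβ.smooth hγ.smooth).sub contDiff_const) (by simp)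
  refine ⟨k, LipschitzWith.of_dist_le_mul fun ρ σ => ?_⟩
  simpa only [dist_sub_right] using hk.dist_le_mul ρ σ

end Field

/-! ### Scalar linear equations with a coefficient of constant sign -/

section Monotonicity

variable {y a : ℝ → ℝ}

theorem monotone_abs_of_hasDerivAt (hy : ∀ t, HasDerivAt y (a t * y t) t) (ha : ∀ t, 0 ≤ a t) :
    Monotone fun t => |y t| := by
  have h : Monotone fun t => y t ^ 2 := by
    refine monotone_of_hasDerivAt_nonneg (fun t => (hy t).pow 2) fun t => ?_
    have := mul_nonneg (ha t) (sq_nonneg (y t))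
    simp only [Pi.zero_apply]
    push_cast
    nlinarith
  exact fun s t hst => sq_le_sq.1 (h hst)

theorem antitone_abs_of_hasDerivAt (hy : ∀ t, HasDerivAt y (-(a t * y t)) t)
    (ha : ∀ t, 0 ≤ a t) : Antitone fun t => |y t| := by
  have h := monotone_abs_of_hasDerivAt (y := fun t => y (-t)) (a := fun t => a (-t))
    (fun t => by
      have := (hy (-t)).scomp t (hasDerivAt_neg t)
      rw [smul_eq_mul, neg_one_mul, neg_neg] at this
      exact this) fun t => ha _
  exact fun s t hst => by simpa using h (neg_le_neg hst)

theorem abs_le_abs_mul_exp_of_hasDerivAt (hy : ∀ t, HasDerivAt y (a t * y t) t)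
    (ha : ∀ t, a t ≤ 1) {t : ℝ} (ht : 0 ≤ t) : |y t| ≤ |y 0| * Real.exp t := by
  have h := antitone_abs_of_hasDerivAt (y := fun t => y t * Real.exp (-t))
    (a := fun t => 1 - a t)
    (fun t => ((hy t).mul (hasDerivAt_neg t).exp).congr_deriv (by ring))
    (fun t => sub_nonneg.2 (ha t)) ht
  simp only [neg_zero, Real.exp_zero, mul_one, abs_mul, Real.abs_exp] at h
  rwa [Real.exp_neg, ← div_eq_mul_inv, div_le_iff₀ (Real.exp_pos t)] at h

end Monotonicity

/-! ### Trajectories along lines and on the racetrack -/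

/-- A point moves along a straight line as long as the vector field is constant on that line. -/
theorem flow_eq_add_smul {d : ℕ} {V : (Fin d → ℝ) → (Fin d → ℝ)} (hV : ContDiff ℝ ∞ V)
    (hb : ∀ x, ‖V x‖ ≤ 1) {x e : Fin d → ℝ} {T : ℝ}
    (h : ∀ s ∈ Set.Ico 0 T, V (x + s • e) = e) {t : ℝ} (ht : t ∈ Set.Icc 0 T) :
    flow V t x = x + t • e := by
  have h1 : ContDiff ℝ 1 V := hV.of_le (by exact_mod_cast le_top)
  have hfc : Continuous fun s => flow V s x :=
    continuous_iff_continuousAt.2 fun s => (hasDerivAt_flow hV hb x s).continuousAt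
  have hgc : Continuous fun s : ℝ => x + s • e := by fun_prop
  obtain ⟨K, hK⟩ := (h1.locallyLipschitz.locallyLipschitzOn
    (s := (fun s => flow V s x) '' Set.Icc 0 T ∪ (fun s : ℝ => x + s • e) '' Set.Icc 0 T)
    ).exists_lipschitzOnWith_of_compact ((isCompact_Icc.image hfc).union (isCompact_Icc.image hgc))
  refine ODE_solution_unique_of_mem_Icc_right (v := fun _ => V) (fun _ _ => hK) hfc.continuousOn
    (fun s _ => (hasDerivAt_flow hV hb x s).hasDerivWithinAt)
    (fun s hs => Or.inl ⟨s, Set.Ico_subset_Icc_self hs, rfl⟩) hgc.continuousOn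
    (fun s hs => ?_) (fun s hs => Or.inr ⟨s, Set.Ico_subset_Icc_self hs, rfl⟩)
    (by simpa using flow_zero hV hb x) ht
  rw [h s hs]
  simpa using (((hasDerivAt_id s).smul_const e).const_add x).hasDerivWithinAt

section Racetrack

variable {R : Set (Fin 2 → ℝ)} {Q : (Fin 2 → ℝ) → (Fin 2 → ℝ)} {m : ℤ}

theorem flow_racetrack_startLine (hQ : IsRacetrack R Q m) {y : ℝ} (hy : |y| < 4) {t : ℝ}
    (ht : t ∈ Set.Icc (0 : ℝ) 24) : flow Q t ![y, -12] = ![y, -12 + t] := by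
  have hb := fun v => norm_le_one_of_mem_cube (hQ.bounded v)
  obtain ⟨hy1, hy2⟩ := abs_lt.1 hy
  have hmem : ∀ s ∈ Set.Ioo (0 : ℝ) 24, ![y, -12 + s] ∈ straight := fun s hs => by
    simp only [straight, dilate_I₀, Set.mem_ofPred_eq, Set.mem_Ioo, Matrix.cons_val_zero,
      Matrix.cons_val_one]
    push_cast
    refine ⟨⟨hy1, hy2⟩, ?_, ?_⟩ <;> linarith [hs.1, hs.2]
  -- the starting line lies in the closure of the straight part, on which the field is constant
  have hcl : ∀ s ∈ Set.Ico (0 : ℝ) 24, ![y, -12 + s] ∈ closure straight := fun s hs => by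
    have hc : Continuous fun r : ℝ => ![y, -12 + r] :=
      continuous_pi fun i => by fin_cases i <;> simp <;> fun_prop
    refine mem_closure_of_tendsto (b := 𝓝[>] s) (hc.continuousAt.tendsto.mono_left
      nhdsWithin_le_nhds) ?_
    filter_upwards [Ioo_mem_nhdsGT hs.2] with r hr
    exact hmem r ⟨hs.1.trans_lt hr.1, hr.2⟩
  have hQ₀ : Set.EqOn Q Q₀ (closure straight) :=
    Set.EqOn.closure hQ.eq_on_straight hQ.smooth.continuous continuous_const
  have hline : ∀ s : ℝ, (![y, -12] + s • ![0, 1] : Fin 2 → ℝ) = ![y, -12 + s] := fun s => by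
    ext i; fin_cases i <;> simp
  rw [← hline]
  refine flow_eq_add_smul hQ.smooth hb (fun s hs => ?_) ht
  rw [hline]
  exact hQ₀ (hcl s hs)

/-- A point that starts in the square `I₀²` on the line at height `-1` leaves this square at time
`2` and does not come back within one lap. -/
theorem flow_racetrack_notMem (hQ : IsRacetrack R Q m) {y : ℝ} (hy : |y| < 1) {t : ℝ}
    (ht : t ∈ Set.Ico (2 : ℝ) m) : flow Q t ![y, -1] ∉ cube 2 I₀ := by
  intro hmem
  have hb := fun v => norm_le_one_of_mem_cube (hQ.bounded v)
  have hy4 : |y| < 4 := hy.trans (by norm_num)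
  have hline := fun {s : ℝ} => flow_racetrack_startLine hQ hy4 (t := s)
  -- the point is the one that left the starting line `11` units of time earlier
  have hshift : flow Q t ![y, -1] = flow Q (t + 11) ![y, -12] := by
    rw [flow_add hQ.smooth hb, hline ⟨by norm_num, by norm_num⟩]
    norm_num
  rw [hshift] at hmem
  have hm1 : (flow Q (t + 11) ![y, -12]) 1 ∈ Set.Ioo (-1 : ℝ) 1 := hmem 1
  have hm0 : (flow Q (t + 11) ![y, -12]) 0 ∈ Set.Ioo (-1 : ℝ) 1 := hmem 0
  have hstart : ![y, -12] ∈ startLine := by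
    obtain ⟨h1, h2⟩ := abs_lt.1 hy4
    simp only [startLine, dilate_I₀, Set.mem_ofPred_eq, Set.mem_Ioo, Matrix.cons_val_zero,
      Matrix.cons_val_one]
    push_cast
    exact ⟨⟨h1, h2⟩, trivial⟩
  rcases le_or_gt t 13 with h13 | h13
  · rw [hline ⟨by linarith [ht.1], by linarith⟩] at hm1
    have := hm1.2
    simp only [Matrix.cons_val_one, Matrix.cons_val_zero] at this
    linarith [ht.1]
  rcases lt_or_ge (t + 11) m with hlt | hge
  · have hst : flow Q (t + 11) ![y, -12] ∈ straight := by
      simp only [straight, dilate_I₀, Set.mem_ofPred_eq, Set.mem_Ioo]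
      push_cast
      refine ⟨⟨?_, ?_⟩, ?_, ?_⟩ <;> linarith [hm0.1, hm0.2, hm1.1, hm1.2]
    have := (hQ.mem_straight_iff _ hstart (t + 11) ⟨by linarith, hlt⟩).1 hst
    linarith
  · have hR : ![y, -12] ∈ R := hQ.track_subset (Or.inl (Or.inr hstart))
    have hlap : flow Q (t + 11) ![y, -12] = flow Q (t + 11 - m) ![y, -12] := by
      conv_rhs => rw [← hQ.periodic _ hR]
      rw [← flow_add hQ.smooth hb, sub_add_cancel]
    rw [hlap, hline ⟨by linarith, by linarith [ht.2]⟩] at hm1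
    have := hm1.1
    simp only [Matrix.cons_val_one, Matrix.cons_val_zero] at this
    linarith [ht.2]

end Racetrack

/-! ### Trajectories of `P₀` -/

section Trajectories

variable {ζ : ℝ → ℝ} {c₀ : (Fin 2 → ℝ) → ℝ} {R : Set (Fin 2 → ℝ)}
  {Q : (Fin 2 → ℝ) → (Fin 2 → ℝ)} {m : ℤ} {β γ : (Fin 4 → ℝ) → ℝ}

theorem norm_P₀_le (hζ : IsStep ζ) (hc₀ : IsSlowing c₀) (hQ : IsRacetrack R Q m)
    (hβ : IsCutoff (dilate 100 I₀) (dilate 200 I₀) β)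
    (hγ : IsCutoff (dilate 300 I₀) (dilate 400 I₀) γ) (ρ : Fin 4 → ℝ) :
    ‖P₀ ζ c₀ Q β γ ρ‖ ≤ 1 :=
  norm_le_one_of_mem_cube (P₀_mem_cube hζ hc₀ hQ.bounded hβ.mem_Icc hγ.mem_Icc ρ)

theorem hasDerivAt_flow_P₀ (hζ : IsStep ζ) (hc₀ : IsSlowing c₀) (hQ : IsRacetrack R Q m)
    (hβ : IsCutoff (dilate 100 I₀) (dilate 200 I₀) β)
    (hγ : IsCutoff (dilate 300 I₀) (dilate 400 I₀) γ) (ρ : Fin 4 → ℝ) (t : ℝ) :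
    HasDerivAt (fun s => flow (P₀ ζ c₀ Q β γ) s ρ)
      (P₀ ζ c₀ Q β γ (flow (P₀ ζ c₀ Q β γ) t ρ)) t :=
  hasDerivAt_flow (contDiff_P₀ hζ hc₀ hQ.smooth hβ.smooth hγ.smooth)
    (norm_P₀_le hζ hc₀ hQ hβ hγ) ρ t

theorem flow_P₀_zero (hζ : IsStep ζ) (hc₀ : IsSlowing c₀) (hQ : IsRacetrack R Q m)
    (hβ : IsCutoff (dilate 100 I₀) (dilate 200 I₀) β)
    (hγ : IsCutoff (dilate 300 I₀) (dilate 400 I₀) γ) (ρ : Fin 4 → ℝ) :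
    flow (P₀ ζ c₀ Q β γ) 0 ρ = ρ :=
  flow_zero (contDiff_P₀ hζ hc₀ hQ.smooth hβ.smooth hγ.smooth) (norm_P₀_le hζ hc₀ hQ hβ hγ) ρ

theorem hasDerivAt_flow_P₀_apply_zero (hζ : IsStep ζ) (hc₀ : IsSlowing c₀)
    (hQ : IsRacetrack R Q m) (hβ : IsCutoff (dilate 100 I₀) (dilate 200 I₀) β)
    (hγ : IsCutoff (dilate 300 I₀) (dilate 400 I₀) γ) (ρ : Fin 4 → ℝ) (t : ℝ) :
    HasDerivAt (fun s => flow (P₀ ζ c₀ Q β γ) s ρ 0)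
      (rate ζ c₀ β γ (flow (P₀ ζ c₀ Q β γ) t ρ) * flow (P₀ ζ c₀ Q β γ) t ρ 0) t := by
  have := hasDerivAt_pi.1 (hasDerivAt_flow_P₀ hζ hc₀ hQ hβ hγ ρ t) 0
  rwa [P₀_apply_zero] at this

theorem hasDerivAt_flow_P₀_apply_one (hζ : IsStep ζ) (hc₀ : IsSlowing c₀)
    (hQ : IsRacetrack R Q m) (hβ : IsCutoff (dilate 100 I₀) (dilate 200 I₀) β)
    (hγ : IsCutoff (dilate 300 I₀) (dilate 400 I₀) γ) (ρ : Fin 4 → ℝ) (t : ℝ) :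
    HasDerivAt (fun s => flow (P₀ ζ c₀ Q β γ) s ρ 1)
      (-(rate ζ c₀ β γ (flow (P₀ ζ c₀ Q β γ) t ρ) * flow (P₀ ζ c₀ Q β γ) t ρ 1)) t := by
  have := hasDerivAt_pi.1 (hasDerivAt_flow_P₀ hζ hc₀ hQ hβ hγ ρ t) 1
  rwa [P₀_apply_one] at this

theorem monotone_abs_flow_P₀_apply_zero (hζ : IsStep ζ) (hc₀ : IsSlowing c₀)
    (hQ : IsRacetrack R Q m) (hβ : IsCutoff (dilate 100 I₀) (dilate 200 I₀) β)
    (hγ : IsCutoff (dilate 300 I₀) (dilate 400 I₀) γ) (ρ : Fin 4 → ℝ) :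
    Monotone fun s => |flow (P₀ ζ c₀ Q β γ) s ρ 0| :=
  monotone_abs_of_hasDerivAt (hasDerivAt_flow_P₀_apply_zero hζ hc₀ hQ hβ hγ ρ)
    fun _ => (rate_nonneg_le hζ hc₀ hβ.mem_Icc hγ.mem_Icc _).1

theorem abs_flow_P₀_apply_zero_le (hζ : IsStep ζ) (hc₀ : IsSlowing c₀)
    (hQ : IsRacetrack R Q m) (hβ : IsCutoff (dilate 100 I₀) (dilate 200 I₀) β)
    (hγ : IsCutoff (dilate 300 I₀) (dilate 400 I₀) γ) (ρ : Fin 4 → ℝ) {t : ℝ} (ht : 0 ≤ t) :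
    |flow (P₀ ζ c₀ Q β γ) t ρ 0| ≤ |ρ 0| * Real.exp t := by
  have := abs_le_abs_mul_exp_of_hasDerivAt (hasDerivAt_flow_P₀_apply_zero hζ hc₀ hQ hβ hγ ρ)
    (fun _ => (rate_nonneg_le hζ hc₀ hβ.mem_Icc hγ.mem_Icc _).2.trans (hc₀.mem_Icc _).2) ht
  rwa [flow_P₀_zero hζ hc₀ hQ hβ hγ] at this

theorem abs_flow_P₀_apply_one_le (hζ : IsStep ζ) (hc₀ : IsSlowing c₀)
    (hQ : IsRacetrack R Q m) (hβ : IsCutoff (dilate 100 I₀) (dilate 200 I₀) β)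
    (hγ : IsCutoff (dilate 300 I₀) (dilate 400 I₀) γ) (ρ : Fin 4 → ℝ) {t : ℝ} (ht : 0 ≤ t) :
    |flow (P₀ ζ c₀ Q β γ) t ρ 1| ≤ |ρ 1| := by
  have := antitone_abs_of_hasDerivAt (hasDerivAt_flow_P₀_apply_one hζ hc₀ hQ hβ hγ ρ)
    (fun _ => (rate_nonneg_le hζ hc₀ hβ.mem_Icc hγ.mem_Icc _).1) ht
  simpa only [flow_P₀_zero hζ hc₀ hQ hβ hγ] using this

/-- As long as the first component is small, the last two components follow the racetrack flow:
since the first component grows and the second one shrinks in absolute value, the trajectory has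
stayed where the cutoff functions are `1`. -/
theorem proj34_flow_P₀ (hζ : IsStep ζ) (hc₀ : IsSlowing c₀)
    (hQ : IsRacetrack R Q m) (hβ : IsCutoff (dilate 100 I₀) (dilate 200 I₀) β)
    (hγ : IsCutoff (dilate 300 I₀) (dilate 400 I₀) γ) {ρ : Fin 4 → ℝ} (hR : proj34 ρ ∈ R)
    (h1 : |ρ 1| ≤ 100) {t : ℝ} (ht : 0 ≤ t) (h0 : |flow (P₀ ζ c₀ Q β γ) t ρ 0| ≤ 100) :
    proj34 (flow (P₀ ζ c₀ Q β γ) t ρ) = flow Q t (proj34 ρ) := by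
  have hb := fun v => norm_le_one_of_mem_cube (hQ.bounded v)
  obtain ⟨k, hk⟩ := exists_lipschitzWith_P₀ hζ hc₀ hQ.smooth hβ hγ
  have hd := fun s => hasDerivAt_proj34 (hasDerivAt_flow_P₀ hζ hc₀ hQ hβ hγ ρ s)
  have hdQ := hasDerivAt_flow hQ.smooth hb (proj34 ρ)
  -- both curves solve the equation obtained by inserting the first two components of the trajectory
  refine ODE_solution_unique_of_mem_Icc_right (K := k) (s := fun _ => Set.univ)
    (v := fun s v => proj34 (P₀ ζ c₀ Q β γ (pair (proj12 (flow (P₀ ζ c₀ Q β γ) s ρ)) v)))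
    (f := fun s => proj34 (flow (P₀ ζ c₀ Q β γ) s ρ)) (g := fun s => flow Q s (proj34 ρ))
    (fun s _ => LipschitzWith.lipschitzOnWith (LipschitzWith.of_dist_le_mul fun v v' => ?_))
    (fun s _ => (hd s).continuousAt.continuousWithinAt) (fun s _ => ?_) (fun _ _ => trivial)
    (fun s _ => (hdQ s).continuousAt.continuousWithinAt) (fun s hs => ?_) (fun _ _ => trivial)
    ?_ ⟨ht, le_rfl⟩
  · rw [dist_eq_norm, dist_eq_norm]
    refine (norm_proj34_sub_le _ _).trans ?_
    rw [← dist_eq_norm]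
    refine (hk.dist_le_mul _ _).trans (mul_le_mul_of_nonneg_left ?_ k.2)
    rw [dist_eq_norm]
    exact norm_pair_sub_pair_le _ _ _
  · rw [pair_proj]
    exact (hd s).hasDerivWithinAt
  · have hv := hQ.subset_cube (hQ.invariant _ hR s)
    rw [dilate_I₀] at hv
    have hv' : ∀ i, |flow Q s (proj34 ρ) i| ≤ 100 := fun i =>
      (abs_lt.2 (hv i)).le.trans (by norm_num)
    have hsmall : ∀ i, |pair (proj12 (flow (P₀ ζ c₀ Q β γ) s ρ)) (flow Q s (proj34 ρ)) i|
        ≤ 100 := fun i => by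
      fin_cases i
      · exact (monotone_abs_flow_P₀_apply_zero hζ hc₀ hQ hβ hγ ρ hs.2.le).trans h0
      · exact (abs_flow_P₀_apply_one_le hζ hc₀ hQ hβ hγ ρ hs.1).trans h1
      · exact hv' 0
      · exact hv' 1
    rw [P₀_eq_PStar hβ hγ hsmall, PStar, proj34_pair, proj34_pair]
    exact (hdQ s).hasDerivWithinAt
  · simp only [flow_P₀_zero hζ hc₀ hQ hβ hγ, flow_zero hQ.smooth hb]

theorem proj34_xi_mem (hQ : IsRacetrack R Q m) : proj34 (xi I₀) ∈ R := by
  have h : proj34 (xi I₀) = ![0, -1] := by rw [xi, halfLen_I₀]; rfl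
  refine hQ.track_subset (Or.inl (Or.inl ?_))
  rw [h]
  simp only [straight, dilate_I₀, Set.mem_ofPred_eq, Set.mem_Ioo, Matrix.cons_val_zero,
    Matrix.cons_val_one]
  norm_num

/-- After one lap a point near `ξ` has moved by less than every power of its distance from `ξ`:
its last two components have returned, and its first two components have moved with a speed that
is controlled by the slowing factor. -/
theorem isBigO_flow_P₀_sub_id (hζ : IsStep ζ) (hc₀ : IsSlowing c₀)
    (hQ : IsRacetrack R Q m) (hβ : IsCutoff (dilate 100 I₀) (dilate 200 I₀) β)
    (hγ : IsCutoff (dilate 300 I₀) (dilate 400 I₀) γ) (N : ℕ) :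
    (flow (P₀ ζ c₀ Q β γ) m - id) =O[𝓝 (xi I₀)] fun ρ => ‖ρ - xi I₀‖ ^ N := by
  have hm : (0 : ℝ) ≤ m := by
    have := hQ.lt_lap
    exact_mod_cast (by omega : (0 : ℤ) ≤ m)
  obtain ⟨C, hC0, hC⟩ := (hc₀.flat.isBigO N).exists_nonneg
  rw [Asymptotics.isBigOWith_iff] at hC
  obtain ⟨r, hr, hball⟩ := Metric.eventually_nhds_iff_ball.1 hC
  have hnear : ∀ᶠ ρ in 𝓝 (xi I₀), ‖ρ - xi I₀‖ * Real.exp m < min r 1 := by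
    have hc : Continuous fun ρ : Fin 4 → ℝ => ‖ρ - xi I₀‖ * Real.exp m := by fun_prop
    refine hc.continuousAt.eventually_lt continuousAt_const ?_
    simpa using hr
  have hR : ∀ᶠ ρ in 𝓝 (xi I₀), proj34 ρ ∈ R :=
    contDiff_proj34.continuous.continuousAt.eventually_mem
      (hQ.isOpen.mem_nhds (proj34_xi_mem hQ))
  refine Asymptotics.IsBigO.of_bound (C * Real.exp m ^ N * m) ?_
  filter_upwards [hnear, hR] with ρ hρ hρR
  set D := ‖ρ - xi I₀‖ * Real.exp m with hD
  have hD0 : 0 ≤ D := by positivity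
  have hDr : D < r := hρ.trans_le (min_le_left _ _)
  have hD1 : D ≤ 1 := (hρ.trans_le (min_le_right _ _)).le
  have hρ0 : |ρ 0| ≤ ‖ρ - xi I₀‖ := by
    simpa [xi] using norm_le_pi_norm (ρ - xi I₀) 0
  have hle : ‖ρ - xi I₀‖ ≤ D := le_mul_of_one_le_right (norm_nonneg _) (Real.one_le_exp hm)
  have hρ1 : |ρ 1| ≤ D := by
    refine le_trans ?_ hle
    simpa [xi] using norm_le_pi_norm (ρ - xi I₀) 1
  have hw : ∀ s ∈ Set.Icc (0 : ℝ) m, |flow (P₀ ζ c₀ Q β γ) s ρ 0| ≤ D := fun s hs =>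
    (abs_flow_P₀_apply_zero_le hζ hc₀ hQ hβ hγ ρ hs.1).trans
      (mul_le_mul hρ0 (Real.exp_le_exp.2 hs.2) (Real.exp_pos _).le (norm_nonneg _))
  have hx : ∀ s ∈ Set.Icc (0 : ℝ) m, |flow (P₀ ζ c₀ Q β γ) s ρ 1| ≤ D := fun s hs =>
    (abs_flow_P₀_apply_one_le hζ hc₀ hQ hβ hγ ρ hs.1).trans hρ1
  have hrate : ∀ s ∈ Set.Icc (0 : ℝ) m,
      |rate ζ c₀ β γ (flow (P₀ ζ c₀ Q β γ) s ρ)| ≤ C * D ^ N := fun s hs => by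
    obtain ⟨hr0, hr1⟩ := rate_nonneg_le hζ hc₀ hβ.mem_Icc hγ.mem_Icc
      (flow (P₀ ζ c₀ Q β γ) s ρ)
    have hu : ‖proj12 (flow (P₀ ζ c₀ Q β γ) s ρ)‖ ≤ D :=
      (pi_norm_le_iff_of_nonneg hD0).2 fun i => by
        fin_cases i
        · exact hw s hs
        · exact hx s hs
    have hc := hball _ (mem_ball_zero_iff.2 (hu.trans_lt hDr))
    rw [sub_zero, norm_pow, norm_norm] at hc
    rw [abs_of_nonneg hr0]
    exact (hr1.trans (le_abs_self _)).trans
      (hc.trans (mul_le_mul_of_nonneg_left (pow_le_pow_left₀ (norm_nonneg _) hu _) hC0))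
  have hE : 0 ≤ C * D ^ N := by positivity
  have hspeed : ∀ {y z : ℝ}, |y| ≤ C * D ^ N → |z| ≤ D → |y * z| ≤ C * D ^ N := fun hy hz => by
    rw [abs_mul]
    exact (mul_le_mul hy (hz.trans hD1) (abs_nonneg _) hE).trans_eq (mul_one _)
  have h0m : (0 : ℝ) ∈ Set.Icc (0 : ℝ) m := ⟨le_rfl, hm⟩
  have hmm : (m : ℝ) ∈ Set.Icc (0 : ℝ) m := ⟨hm, le_rfl⟩
  have hdw : |flow (P₀ ζ c₀ Q β γ) m ρ 0 - ρ 0| ≤ C * D ^ N * m := by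
    have := Convex.norm_image_sub_le_of_norm_hasDerivWithin_le (s := Set.Icc (0 : ℝ) m)
      (C := C * D ^ N)
      (fun s _ => (hasDerivAt_flow_P₀_apply_zero hζ hc₀ hQ hβ hγ ρ s).hasDerivWithinAt)
      (fun s hs => hspeed (hrate s hs) (hw s hs)) (convex_Icc _ _) h0m hmm
    simpa only [flow_P₀_zero hζ hc₀ hQ hβ hγ, sub_zero, Real.norm_eq_abs, abs_of_nonneg hm]
      using this
  have hdx : |flow (P₀ ζ c₀ Q β γ) m ρ 1 - ρ 1| ≤ C * D ^ N * m := by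
    have := Convex.norm_image_sub_le_of_norm_hasDerivWithin_le (s := Set.Icc (0 : ℝ) m)
      (C := C * D ^ N)
      (fun s _ => (hasDerivAt_flow_P₀_apply_one hζ hc₀ hQ hβ hγ ρ s).hasDerivWithinAt)
      (fun s hs => by
        rw [norm_neg]
        exact hspeed (hrate s hs) (hx s hs)) (convex_Icc _ _) h0m hmm
    simpa only [flow_P₀_zero hζ hc₀ hQ hβ hγ, sub_zero, Real.norm_eq_abs, abs_of_nonneg hm]
      using this
  have hv : proj34 (flow (P₀ ζ c₀ Q β γ) m ρ) = proj34 ρ := by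
    rw [proj34_flow_P₀ hζ hc₀ hQ hβ hγ hρR (hρ1.trans (hD1.trans (by norm_num))) hm
      ((hw m hmm).trans (hD1.trans (by norm_num))), hQ.periodic _ hρR]
  rw [norm_pow, norm_norm]
  have hbound : C * Real.exp m ^ N * m * ‖ρ - xi I₀‖ ^ N = C * D ^ N * m := by
    rw [hD, mul_pow]; ring
  rw [hbound]
  refine (pi_norm_le_iff_of_nonneg (by positivity)).2 fun i => ?_
  fin_cases i
  · exact hdw
  · exact hdx
  · have : flow (P₀ ζ c₀ Q β γ) m ρ 2 = ρ 2 := congrFun hv 0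
    simp [this]
    positivity
  · have : flow (P₀ ζ c₀ Q β γ) m ρ 3 = ρ 3 := congrFun hv 1
    simp [this]
    positivity

theorem agreeToAllOrders_flow_P₀ (hζ : IsStep ζ) (hc₀ : IsSlowing c₀)
    (hQ : IsRacetrack R Q m) (hβ : IsCutoff (dilate 100 I₀) (dilate 200 I₀) β)
    (hγ : IsCutoff (dilate 300 I₀) (dilate 400 I₀) γ) :
    AgreeToAllOrders (flow (P₀ ζ c₀ Q β γ) m) id (xi I₀) := by
  obtain ⟨k, hk⟩ := exists_lipschitzWith_P₀ hζ hc₀ hQ.smooth hβ hγ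
  have hm : (0 : ℝ) ≤ m := by
    have := hQ.lt_lap
    exact_mod_cast (by omega : (0 : ℤ) ≤ m)
  exact agreeToAllOrders_of_isBigO
    (contDiff_flow (contDiff_P₀ hζ hc₀ hQ.smooth hβ.smooth hγ.smooth)
      (norm_P₀_le hζ hc₀ hQ hβ hγ) hk hm).contDiffAt contDiff_id.contDiffAt
    (isBigO_flow_P₀_sub_id hζ hc₀ hQ hβ hγ)

theorem flow_P₀_mem_cube_iff (hζ : IsStep ζ) (hc₀ : IsSlowing c₀)
    (hQ : IsRacetrack R Q m) (hβ : IsCutoff (dilate 100 I₀) (dilate 200 I₀) β)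
    (hγ : IsCutoff (dilate 300 I₀) (dilate 400 I₀) γ) {τ : Fin 4 → ℝ} (hτ : τ ∈ bottom I₀)
    {t : ℝ} (ht : t ∈ Set.Ioo (0 : ℝ) m) :
    flow (P₀ ζ c₀ Q β γ) t τ ∈ cube 4 I₀ ↔ t < 2 := by
  obtain ⟨h0, h1, h2, h3⟩ := hτ
  rw [halfLen_I₀] at h3
  constructor
  · -- a point of the cube has a small first component, so that the racetrack flow governs the
    -- last two components up to time `t`
    intro hmem
    by_contra! h2t
    have hτ34 : proj34 τ = ![τ 2, -1] := by rw [proj34, h3]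
    have hy : |τ 2| < 1 := abs_lt.2 h2
    have hR : proj34 τ ∈ R := by
      refine hQ.track_subset (Or.inl (Or.inl ?_))
      rw [hτ34]
      simp only [straight, dilate_I₀, Set.mem_ofPred_eq, Set.mem_Ioo, Matrix.cons_val_zero,
        Matrix.cons_val_one]
      have := abs_lt.1 hy
      norm_num
      constructor <;> linarith
    have hw : |flow (P₀ ζ c₀ Q β γ) t τ 0| ≤ 100 :=
      (abs_lt.2 (hmem 0)).le.trans (by norm_num)
    have hv := proj34_flow_P₀ hζ hc₀ hQ hβ hγ hR ((abs_lt.2 h1).le.trans (by norm_num))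
      ht.1.le hw
    rw [hτ34] at hv
    refine flow_racetrack_notMem hQ hy ⟨h2t, ht.2⟩ ?_
    rw [← hv]
    intro i
    fin_cases i
    · exact hmem 2
    · exact hmem 3
  · intro h2t
    have hline : ∀ s : ℝ, τ + s • ![0, 0, 0, 1] = ![τ 0, τ 1, τ 2, -1 + s] := fun s => by
      ext i; fin_cases i <;> simp [h3]
    rw [flow_eq_add_smul (contDiff_P₀ hζ hc₀ hQ.smooth hβ.smooth hγ.smooth)
      (norm_P₀_le hζ hc₀ hQ hβ hγ) (e := ![0, 0, 0, 1]) (T := 2) (fun s hs => ?_)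
      ⟨ht.1.le, h2t.le⟩, hline]
    · intro i
      fin_cases i
      · exact h0
      · exact h1
      · exact h2
      · change -1 + t ∈ Set.Ioo (-1 : ℝ) 1
        exact ⟨by linarith [ht.1], by linarith⟩
    · rw [hline]
      refine P₀_eq_V₀_of_mem hζ hβ hγ hQ.eq_on_straight fun i => ?_
      fin_cases i
      · exact (abs_lt.2 h0).le.trans (by norm_num)
      · exact (abs_lt.2 h1).le.trans (by norm_num)
      · exact (abs_lt.2 h2).le.trans (by norm_num)
      · change |-1 + s| ≤ 3
        exact abs_le.2 ⟨by linarith [hs.1], by linarith [hs.2]⟩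

end Trajectories


end WaterPump

theorem mainTheorem5
    (ζ : ℝ → ℝ) (hζ : WaterPump.IsStep ζ)
    (c₀ : (Fin 2 → ℝ) → ℝ) (hc₀ : WaterPump.IsSlowing c₀)
    (R : Set (Fin 2 → ℝ)) (Q : (Fin 2 → ℝ) → (Fin 2 → ℝ)) (m : ℤ)
    (hQ : WaterPump.IsRacetrack R Q m)
    (β γ : (Fin 4 → ℝ) → ℝ)
    (hβ : WaterPump.IsCutoff (WaterPump.dilate 100 WaterPump.I₀)
      (WaterPump.dilate 200 WaterPump.I₀) β)
    (hγ : WaterPump.IsCutoff (WaterPump.dilate 300 WaterPump.I₀)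
      (WaterPump.dilate 400 WaterPump.I₀) γ) :
    (WaterPump.P₀ ζ c₀ Q β γ, WaterPump.K₀) ∈ WaterPump.scrP WaterPump.I₀ := by
  have hbf : WaterPump.P₀ ζ c₀ Q β γ ∈ WaterPump.boundedFields :=
    ⟨WaterPump.contDiff_P₀ hζ hc₀ hQ.smooth hβ.smooth hγ.smooth,
      WaterPump.P₀_mem_cube hζ hc₀ hQ.bounded hβ.mem_Icc hγ.mem_Icc⟩
  refine ⟨⟨⟨hbf, ⟨400, by norm_num, WaterPump.dilate_I₀ 400⟩,
    fun σ hσ => WaterPump.P₀_eq_V₀_of_notMem hγ hσ⟩, ?_, hbf, fun σ hσ => ?_⟩, m, ?_,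
    WaterPump.agreeToAllOrders_flow_P₀ hζ hc₀ hQ hβ hγ, fun τ hτ t ht => ?_⟩
  · simp only [WaterPump.K₀, WaterPump.dilate_I₀]
    exact Set.Ioo_subset_Ioo (by norm_num) (by norm_num)
  · rw [WaterPump.closure_dilate_I₀ (by norm_num)] at hσ
    exact WaterPump.P₀_eq_V₀_of_mem hζ hβ hγ hQ.eq_on_straight fun i =>
      abs_le.2 (by exact_mod_cast hσ i)
  · rw [WaterPump.halfLen_I₀]
    have := hQ.lt_lap
    exact_mod_cast (by omega : (2 : ℤ) * 1 < m)
  · rw [WaterPump.halfLen_I₀, mul_one]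
    exact WaterPump.flow_P₀_mem_cube_iff hζ hc₀ hQ hβ hγ hτ ht
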